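/- Let $p$ be an odd prime, let $1\le m_1<m_2<m_3<\cdots$ be integers, and let $T$ be the rooted tree in which every vertex at distance $i-1$ from the root has $p^{m_i}$ children ($i\ge 1$), labelled by $1,2,\dots,p^{m_i}$. Let $e_1,\dots,e_{p^{m_1}-1}$ be integers with $|e_j|\le p^{m_2}-1$, not all divisible by $p$. For $n\ge 0$ let $a_n$ be the automorphism of the subtree hanging from a vertex at distance $n$ from the root (with branching numbers $p^{m_{n+1}},p^{m_{n+2}},\dots$) that permutes the first letters of words by the cycle $(1\,2\,\cdots\,p^{m_{n+1}})$ and changes no other letter, and let $b_n$ be the automorphism of that subtree that fixes all vertices of its first level and is defined recursively by its sections there: $a_{n+1}^{e_j}$ at the letter $j$ for $1\le j\le p^{m_1}-1$, $b_{n+1}$ at the last letter $p^{m_{n+1}}$, and the identity at all other letters. Put $a=a_0$, $b=b_0$, let $G=\langle a,b\rangle\le \operatorname{Aut}T$ be the growing GGS-group with defining vector $\mathbf e=(e_1,\dots,e_{p^{m_1}-1})$, and let $\mathrm{St}_G(n)$ be the subgroup of elements of $G$ fixing all vertices at distance $n$ from the root. (A product $fg$ of automorphisms means: first $g$, then $f$.)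 For elements $x,y$ of a group $H$ let $\Sigma(x,y)$ be the union of all conjugates of $\langle x\rangle$, $\langle y\rangle$ and $\langle xy\rangle$. A Beauville structure for $H$ consists of two generating sets $\{x_1,y_1\}$ and $\{x_2,y_2\}$ of $H$ with $\Sigma(x_1,y_1)\cap\Sigma(x_2,y_2)=\{1\}$, and $H$ is a Beauville group if it is finite, has minimal number of generators two (equivalently here, is non-trivial), and has a Beauville structure. (i) If $\sum_{j=1}^{p^{m_1}-1}e_j=0$, then $G/\mathrm{St}_G(n)$ is a Beauville group for every $n\ge 3$. If moreover $p\ge 5$, then the images of $\{a^{-2},ab\}$ and $\{ab^2,b\}$ form a Beauville structure for $G/\mathrm{St}_G(n)$. (ii) If $\sum_{j=1}^{p^{m_1}-1}e_j\not\equiv 0\pmod p$, then for every $n\ge 1$ the group $G/\mathrm{St}_G(n)$ is not a Beauville group; in fact it has a non-trivial cyclic central subgroup that is contained in $\Sigma(x,y)$ for every generating set $\{x,y\}$ of $G/\mathrm{St}_G(n)$. -/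

import Mathlib

namespace GrowingGGS

/-! ### Spherically homogeneous rooted trees and their automorphisms

A branching sequence is a function `q : ℕ → ℕ`, where `q i` is the number of children of a vertex
of length `i`.  The alphabet used at length `i` is `ZMod (q i)`: the letters `1, 2, …, q i` are
read as residue classes, so that the last letter `q i` is the class `0`. -/

/-- The branching sequence of the subtrees hanging from the vertices of the first level. -/
def shift (q : ℕ → ℕ) : ℕ → ℕ := fun i => q (i + 1)

/-- The vertices of length `n`, i.e. the words `x₁ x₂ ⋯ xₙ` with `xᵢ` in the `i`-th alphabet. -/
def Level : (ℕ → ℕ) → ℕ → Type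
  | _, 0 => Unit
  | q, n + 1 => ZMod (q 0) × Level (shift q) n

/-- The parent of a vertex of length `n + 1`: the word with its last letter deleted. -/
def parent : (q : ℕ → ℕ) → (n : ℕ) → Level q (n + 1) → Level q n
  | _, 0, _ => ()
  | q, n + 1, v => ((v.1, parent (shift q) n v.2) : ZMod (q 0) × Level (shift q) n)

/-- The automorphism group of the rooted tree: families of permutations of the levels that
respect the parent relation. The product `f * g` is composition, `g` being applied first. -/
def AutT (q : ℕ → ℕ) : Subgroup (∀ n : ℕ, Equiv.Perm (Level q n)) where
  carrier := {f | ∀ (n : ℕ) (v : Level q (n + 1)), parent q n (f (n + 1) v) = f n (parent q n v)}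
  mul_mem' := by
    intro f g hf hg n v
    simp only [Set.mem_ofPred_eq] at hf hg
    simp only [Pi.mul_apply, Equiv.Perm.mul_apply, hf, hg]
  one_mem' := by
    intro n v
    simp
  inv_mem' := by
    intro f hf n v
    simp only [Set.mem_ofPred_eq] at hf
    simp only [Pi.inv_apply]
    rw [Equiv.Perm.eq_inv_iff_eq, ← hf]
    exact congrArg _ (Equiv.apply_symm_apply (f (n + 1)) v)

/-- The permutation of level `n` induced by the rooted automorphism of the cycle
`(1 2 ⋯ q 0)`: it adds `1` to the first letter. -/
def rootedLevel (q : ℕ → ℕ) : (n : ℕ) → Equiv.Perm (Level q n)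
  | 0 => 1
  | n + 1 =>
    ((Equiv.addRight (1 : ZMod (q 0))).prodCongr (Equiv.refl (Level (shift q) n)) :
      Equiv.Perm (ZMod (q 0) × Level (shift q) n))

/-- The permutation of level `n` induced by the directed automorphism `b` of the tree with
branching sequence `q`.  It fixes the first level; its section at the letter `j` is
`a ^ (e j)` for `1 ≤ j ≤ k - 1`, where `a` is the rooted automorphism of the subtree, it is the
directed automorphism `b` of the subtree at the last letter, and it is trivial at all other
letters.  Here `k` is the branching number at the root of the original tree, and it
stays the same along the recursion. -/
def directedLevel (k : ℕ) (e : ℕ → ℤ) : (q : ℕ → ℕ) → (n : ℕ) → Equiv.Perm (Level q n)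
  | _, 0 => 1
  | q, n + 1 =>
    (Equiv.prodShear (Equiv.refl (ZMod (q 0))) (fun x =>
        if x = 0 then directedLevel k e (shift q) n
        else if x.val < k then rootedLevel (shift q) n ^ e x.val
        else 1) :
      Equiv.Perm (ZMod (q 0) × Level (shift q) n))

theorem rootedLevel_mem (q : ℕ → ℕ) : rootedLevel q ∈ AutT q := by
  intro n v
  cases n with
  | zero => rfl
  | succ n => rfl

theorem directedLevel_mem (k : ℕ) (e : ℕ → ℤ) (q : ℕ → ℕ) : directedLevel k e q ∈ AutT q := by
  intro n
  induction n generalizing q with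
  | zero => intro v; rfl
  | succ n ih =>
    rintro ⟨x, v⟩
    change (x, parent (shift q) n ((if x = 0 then directedLevel k e (shift q) (n + 1)
        else if x.val < k then rootedLevel (shift q) (n + 1) ^ e x.val else 1) v)) =
      (x, (if x = 0 then directedLevel k e (shift q) n
        else if x.val < k then rootedLevel (shift q) n ^ e x.val else 1) (parent (shift q) n v))
    congr 1
    split_ifs
    · exact ih (shift q) v
    · exact (AutT (shift q)).zpow_mem (rootedLevel_mem (shift q)) (e x.val) n v
    · rfl

/-! ### Growing GGS-groups

The exponents are indexed from `0`: the tree has branching sequence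
`p ^ m 0, p ^ m 1, p ^ m 2, …`.  Of the function `e : ℕ → ℤ` only the entries
`e 1, …, e (p ^ m 0 - 1)` are used. -/

/-- The branching sequence `p ^ m 0, p ^ m 1, …`. -/
def branching (p : ℕ) (m : ℕ → ℕ) : ℕ → ℕ := fun i => p ^ m i

/-- The rooted automorphism `a`. -/
def rootedAut (p : ℕ) (m : ℕ → ℕ) : AutT (branching p m) :=
  ⟨rootedLevel (branching p m), rootedLevel_mem _⟩

/-- The directed automorphism `b` of the defining vector `(e 1, …, e (p ^ m 0 - 1))`. -/
def directedAut (p : ℕ) (m : ℕ → ℕ) (e : ℕ → ℤ) : AutT (branching p m) :=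
  ⟨directedLevel (p ^ m 0) e (branching p m), directedLevel_mem _ _ _⟩

/-- The growing GGS-group `⟨a, b⟩`. -/
def group (p : ℕ) (m : ℕ → ℕ) (e : ℕ → ℤ) : Subgroup (AutT (branching p m)) :=
  Subgroup.closure {rootedAut p m, directedAut p m e}

/-- The generator `a` as an element of the growing GGS-group. -/
def genA (p : ℕ) (m : ℕ → ℕ) (e : ℕ → ℤ) : group p m e :=
  ⟨rootedAut p m, Subgroup.subset_closure (by simp)⟩

/-- The generator `b` as an element of the growing GGS-group. -/
def genB (p : ℕ) (m : ℕ → ℕ) (e : ℕ → ℤ) : group p m e :=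
  ⟨directedAut p m e, Subgroup.subset_closure (by simp)⟩

/-- The `n`-th level stabiliser of a group of tree automorphisms. -/
def levelStabilizer {q : ℕ → ℕ} (G : Subgroup (AutT q)) (n : ℕ) : Subgroup G where
  carrier := {g | ∀ v : Level q n, (g : AutT q).1 n v = v}
  mul_mem' := by
    intro f g hf hg v
    have h1 := hf v
    have h2 := hg v
    simp only [Subgroup.coe_mul, Pi.mul_apply, Equiv.Perm.mul_apply, h1, h2]
  one_mem' := by
    intro v
    rfl
  inv_mem' := by
    intro f hf v
    simp only [Subgroup.coe_inv, Pi.inv_apply]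
    rw [Equiv.Perm.inv_eq_iff_eq]
    exact (hf v).symm

instance levelStabilizer_normal {q : ℕ → ℕ} (G : Subgroup (AutT q)) (n : ℕ) :
    (levelStabilizer G n).Normal where
  conj_mem := by
    intro f hf g v
    have h1 := hf (((g : AutT q).1 n)⁻¹ v)
    simp only [Subgroup.coe_mul, Subgroup.coe_inv, Pi.mul_apply, Pi.inv_apply,
      Equiv.Perm.mul_apply, h1]
    exact Equiv.apply_symm_apply ((g : AutT q).1 n) v

/-! ### Beauville groups -/

/-- `Σ(x, y)`: the union of all conjugates of the cyclic subgroups `⟨x⟩`, `⟨y⟩`, `⟨xy⟩`. -/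
def beauvilleSigma {H : Type*} [Group H] (x y : H) : Set H :=
  {h | ∃ g : H, g⁻¹ * h * g ∈ Subgroup.zpowers x ∨ g⁻¹ * h * g ∈ Subgroup.zpowers y ∨
    g⁻¹ * h * g ∈ Subgroup.zpowers (x * y)}

/-- `{x₁, y₁}` and `{x₂, y₂}` form a Beauville structure for `H`. -/
structure IsBeauvilleStructure {H : Type*} [Group H] (x₁ y₁ x₂ y₂ : H) : Prop where
  generates_left : Subgroup.closure {x₁, y₁} = (⊤ : Subgroup H)
  generates_right : Subgroup.closure {x₂, y₂} = (⊤ : Subgroup H)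
  inter_eq : beauvilleSigma x₁ y₁ ∩ beauvilleSigma x₂ y₂ = {1}

/-- A Beauville group: a finite group with a Beauville structure whose minimal number of
generators is two.  For a nontrivial group the condition `¬ IsCyclic H` follows from the existence
of a Beauville structure; it only serves to exclude the trivial group. -/
structure IsBeauvilleGroup (H : Type*) [Group H] : Prop where
  finite : Finite H
  not_cyclic : ¬ IsCyclic H
  exists_structure : ∃ x₁ y₁ x₂ y₂ : H, IsBeauvilleStructure x₁ y₁ x₂ y₂

end GrowingGGS

/-!
The argument reads everything off the action on one level `n`, by recursion on the first letter: an
element of the group is a node `(t, s)`, which adds `t` to the first letter and acts on the rest of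
a word with first letter `u` by the section `s u` (`node`, `node_mul`, `node_pow`).

*Sum prime to `p`.* Summing the labels of an element over the vertices of length `l` gives
homomorphisms to `ZMod (q l)` (`HasLabelSums`). On `a ^ i * b ^ j` modulo commutators they take the
value `i` for `l = 0` and `j * ∑ eᵢ` for `l > 0`. If all of them are units, the element permutes each
level in one cycle, and its power by the number of vertices of length `n - 1` adds one and the same
unit to every last letter (`HasLabelSums.pow_prod_eq_lastRot`). Rotations of the last letter are
central. Of a generating pair `x, y` one of `x`, `y`, `x * y` has both exponents prime to `p`, so
`Σ(x, y)` always contains the group of rotations of the last letter (`exists_central_subgroup`).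

*Sum zero.* For `i` prime to `p`, the contributions of `a` to the section of `(a ^ i * b ^ j) ^ q 0`
at the letter `0` cancel, and this section is `b ^ j` (`exists_pow_eq_node`). As a power of `b`
commuting with `a` is trivial, no nontrivial power of `b` or of `a * b ^ j` is central in
`G / St(n)` for `n ≥ 3` (`rooted_mul_directed_zpow_eq_one_of_commute`). If `x` and `y` are
independent modulo the Frattini subgroup, they generate the finite `p`-group even after
conjugation, so a common element of conjugates of `⟨x⟩` and `⟨y⟩` is central; hence it is trivial as
soon as `x` is one of these elements (`ConjTrivialInter.of_hasNoCentralPower`). For `p ≥ 5` the six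
cyclic groups of the given pairs are pairwise independent across the two triples. For `p = 3` there
are only four directions modulo the Frattini subgroup, and two of them have to be shared: the pair
`a, b` is combined with `a * b ^ 3` and with an element `y` in the direction of `b`. Powers of order
`3` of `a * b ^ 3` fix the first level, those of `a` do not. Powers of order `3` of `b` have one
nontrivial section only, and `y` is chosen so that its powers do not have this property: if
`m 0 ≥ 2` take `y = a ^ 3 * b⁻¹`, which moves all letters of the first level, and if `m 0 = 1` take
`y = b * (a * b * a⁻¹)`, which has two sections of the same order.
-/

namespace GrowingGGS

/-! ### Permutations of a level in terms of first letters -/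

section Nodes

variable {q : ℕ → ℕ} {n : ℕ}

/-- The permutation of level `n + 1` that adds `t` to the first letter and acts on the remaining
letters of a word with first letter `u` by `s u`. -/
def node (t : ZMod (q 0)) (s : ZMod (q 0) → Equiv.Perm (Level (shift q) n)) :
    Equiv.Perm (Level q (n + 1)) :=
  (Equiv.prodShear (Equiv.addRight t) s : Equiv.Perm (ZMod (q 0) × Level (shift q) n))

theorem nonempty_level : ∀ (q : ℕ → ℕ) (n : ℕ), Nonempty (Level q n)
  | _, 0 => ⟨()⟩
  | q, n + 1 => (nonempty_level (shift q) n).map fun v => ((0, v) : ZMod (q 0) × Level (shift q) n)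

theorem finite_level : ∀ (q : ℕ → ℕ) (n : ℕ), (∀ i, q i ≠ 0) → Finite (Level q n)
  | _, 0, _ => inferInstanceAs (Finite Unit)
  | q, n + 1, h => by
    have := finite_level (shift q) n fun i => h (i + 1)
    have : NeZero (q 0) := ⟨h 0⟩
    exact inferInstanceAs (Finite (ZMod (q 0) × Level (shift q) n))

theorem node_inj {t t' : ZMod (q 0)} {s s' : ZMod (q 0) → Equiv.Perm (Level (shift q) n)} :
    node t s = node t' s' ↔ t = t' ∧ s = s' := by
  refine ⟨fun h => ?_, fun ⟨h, h'⟩ => by rw [h, h']⟩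
  have key : ∀ (u : ZMod (q 0)) (v : Level (shift q) n),
      ((u + t, s u v) : ZMod (q 0) × Level (shift q) n) = (u + t', s' u v) :=
    fun u v => DFunLike.congr_fun h ((u, v) : ZMod (q 0) × Level (shift q) n)
  obtain ⟨v₀⟩ := nonempty_level (shift q) n
  refine ⟨by simpa using congrArg Prod.fst (key 0 v₀), ?_⟩
  funext u
  ext v
  exact congrArg Prod.snd (key u v)

theorem node_mul (t t' : ZMod (q 0)) (s s' : ZMod (q 0) → Equiv.Perm (Level (shift q) n)) :
    node t s * node t' s' = node (t + t') fun u => s (u + t') * s' u := by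
  refine Equiv.ext fun ⟨u, v⟩ => ?_
  change ((u + t' + t, s (u + t') (s' u v)) : ZMod (q 0) × Level (shift q) n) =
    (u + (t + t'), s (u + t') (s' u v))
  rw [add_assoc, add_comm t' t]

theorem node_zero_one :
    node (0 : ZMod (q 0)) (1 : ZMod (q 0) → Equiv.Perm (Level (shift q) n)) = 1 := by
  refine Equiv.ext fun ⟨u, v⟩ => ?_
  change ((u + 0, v) : ZMod (q 0) × Level (shift q) n) = (u, v)
  rw [add_zero]

theorem node_eq_one {t : ZMod (q 0)} {s : ZMod (q 0) → Equiv.Perm (Level (shift q) n)} :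
    node t s = 1 ↔ t = 0 ∧ s = 1 := by
  rw [← node_zero_one, node_inj]

theorem node_inv (t : ZMod (q 0)) (s : ZMod (q 0) → Equiv.Perm (Level (shift q) n)) :
    (node t s)⁻¹ = node (-t) fun u => (s (u - t))⁻¹ := by
  rw [inv_eq_iff_mul_eq_one, node_mul, node_eq_one]
  refine ⟨add_neg_cancel t, ?_⟩
  funext u
  simp [sub_eq_add_neg]

theorem node_zero_zpow (s : ZMod (q 0) → Equiv.Perm (Level (shift q) n)) (c : ℤ) :
    node 0 s ^ c = node 0 (s ^ c) := by
  let f : (ZMod (q 0) → Equiv.Perm (Level (shift q) n)) →* Equiv.Perm (Level q (n + 1)) :=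
    { toFun := node 0
      map_one' := node_zero_one
      map_mul' := fun s s' => by
        rw [node_mul, add_zero]
        simp only [add_zero]
        rfl }
  exact (map_zpow f s c).symm

theorem node_zero_pow (s : ZMod (q 0) → Equiv.Perm (Level (shift q) n)) (c : ℕ) :
    node 0 s ^ c = node 0 (s ^ c) := by
  simpa using node_zero_zpow s c

/-- `pathProd t s c u` is the product of the sections of `node t s` met along the first `c` steps
of the orbit of `u`; it is the section at `u` of the `c`-th power of `node t s`. -/
def pathProd (t : ZMod (q 0)) (s : ZMod (q 0) → Equiv.Perm (Level (shift q) n)) :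
    ℕ → ZMod (q 0) → Equiv.Perm (Level (shift q) n)
  | 0, _ => 1
  | c + 1, u => s (u + (c : ZMod (q 0)) * t) * pathProd t s c u

theorem node_pow (t : ZMod (q 0)) (s : ZMod (q 0) → Equiv.Perm (Level (shift q) n)) (c : ℕ) :
    node t s ^ c = node ((c : ZMod (q 0)) * t) (pathProd t s c) := by
  induction c with
  | zero =>
    rw [pow_zero, eq_comm, node_eq_one]
    exact ⟨by simp, rfl⟩
  | succ c ih =>
    rw [pow_succ', ih, node_mul, node_inj]
    exact ⟨by push_cast; ring, rfl⟩

theorem exists_node_zpow (t : ZMod (q 0)) (s : ZMod (q 0) → Equiv.Perm (Level (shift q) n))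
    (c : ℤ) : ∃ s', node t s ^ c = node ((c : ZMod (q 0)) * t) s' := by
  cases c with
  | ofNat c => exact ⟨_, by simpa using node_pow t s c⟩
  | negSucc c =>
    refine ⟨fun u => (pathProd t s (c + 1) (u - ((c + 1 : ℕ) : ZMod (q 0)) * t))⁻¹, ?_⟩
    rw [zpow_negSucc, node_pow, node_inv, node_inj]
    refine ⟨?_, rfl⟩
    rw [Int.cast_negSucc]
    ring

theorem commute_node_iff {t t' : ZMod (q 0)}
    {s s' : ZMod (q 0) → Equiv.Perm (Level (shift q) n)} :
    Commute (node t s) (node t' s') ↔ ∀ u, s (u + t') * s' u = s' (u + t) * s u := by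
  rw [Commute, SemiconjBy, node_mul, node_mul, node_inj, funext_iff]
  exact and_iff_right (add_comm t t')

/-! ### The generators -/

theorem rootedLevel_succ : rootedLevel q (n + 1) = node 1 1 := rfl

theorem rootedLevel_zpow (c : ℤ) : rootedLevel q (n + 1) ^ c = node (c : ZMod (q 0)) 1 := by
  rw [rootedLevel_succ]
  induction c using Int.induction_on with
  | zero => rw [zpow_zero, Int.cast_zero, node_zero_one]
  | succ c ih =>
    rw [zpow_add_one, ih, node_mul, node_inj]
    exact ⟨by push_cast; rfl, by funext u; simp⟩
  | pred c ih =>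
    rw [zpow_sub_one, ih, node_inv, node_mul, node_inj]
    exact ⟨by push_cast; ring, by funext u; simp⟩

/-- The exponents of the rooted automorphism in the sections of the directed automorphism, with
value `0` at the letters where the section is trivial or directed. -/
def sectionExp (k : ℕ) (e : ℕ → ℤ) {q : ℕ → ℕ} (u : ZMod (q 0)) : ℤ :=
  if u = 0 then 0 else if u.val < k then e u.val else 0

variable (k : ℕ) (e : ℕ → ℤ)

theorem sectionExp_zero : sectionExp k e (0 : ZMod (q 0)) = 0 := if_pos rfl

theorem directedLevel_zpow (c : ℤ) : directedLevel k e q (n + 1) ^ c =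
    node 0 fun u => if u = 0 then directedLevel k e (shift q) n ^ c
      else rootedLevel (shift q) n ^ (sectionExp k e u * c) := by
  have h : directedLevel k e q (n + 1) = node 0 fun u => if u = 0 then directedLevel k e (shift q) n
      else rootedLevel (shift q) n ^ sectionExp k e u := by
    refine Equiv.ext fun ⟨u, v⟩ => ?_
    change ((u, (if u = 0 then directedLevel k e (shift q) n
        else if u.val < k then rootedLevel (shift q) n ^ e u.val else 1) v) :
        ZMod (q 0) × Level (shift q) n) =
      (u + 0, (if u = 0 then directedLevel k e (shift q) n
        else rootedLevel (shift q) n ^ sectionExp k e u) v)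
    rw [add_zero, sectionExp]
    split_ifs <;> simp
  rw [h, node_zero_zpow, node_inj]
  refine ⟨rfl, ?_⟩
  funext u
  rw [Pi.pow_apply]
  split_ifs
  · rfl
  · rw [zpow_mul]

theorem directedLevel_succ : directedLevel k e q (n + 1) =
    node 0 fun u => if u = 0 then directedLevel k e (shift q) n
      else rootedLevel (shift q) n ^ sectionExp k e u := by
  simpa using directedLevel_zpow (q := q) (n := n) k e 1

theorem directedLevel_one : directedLevel k e q 1 = 1 := by
  rw [directedLevel_succ, node_eq_one]
  exact ⟨rfl, funext fun u => Subsingleton.elim (α := Equiv.Perm Unit) _ _⟩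

end Nodes

/-! ### Label sums -/

theorem sum_range_natCast_zmod {M : Type*} [AddCommMonoid M] {N : ℕ} [NeZero N]
    (f : ZMod N → M) : ∑ c ∈ Finset.range N, f (c : ZMod N) = ∑ u, f u := by
  refine Finset.sum_nbij' (fun c => (c : ZMod N)) ZMod.val (by simp) (fun u _ => ?_)
    (fun c hc => ?_) (fun u _ => ZMod.natCast_zmod_val u) (fun _ _ => rfl)
  · exact Finset.mem_range.2 (ZMod.val_lt u)
  · exact ZMod.val_cast_of_lt (Finset.mem_range.1 hc)

theorem sum_range_orbit {M : Type*} [AddCommMonoid M] {N : ℕ} [NeZero N]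
    (f : ZMod N → M) (u : ZMod N) {t : ZMod N} (ht : IsUnit t) :
    ∑ c ∈ Finset.range N, f (u + (c : ZMod N) * t) = ∑ v, f v := by
  rw [sum_range_natCast_zmod fun c => f (u + c * t)]
  obtain ⟨t, rfl⟩ := ht
  exact Fintype.sum_equiv ((Units.mulRight t).trans (Equiv.addLeft u)) _ _ fun _ => rfl

/-- `HasLabelSums q n g L` says that the permutation `g` of level `n` acts on the letters below
every vertex by a translation (the label of the vertex), and that for `i < n` the sum of the labels
of the vertices of length `i` is `L i`; such an `L` is unique, as the
entries `L i` with `i ≥ n` are zero. -/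
def HasLabelSums : (q : ℕ → ℕ) → (n : ℕ) → Equiv.Perm (Level q n) → (∀ i, ZMod (q i)) → Prop
  | _, 0, _, L => L = 0
  | q, n + 1, g, L => ∃ (t : ZMod (q 0)) (s : ZMod (q 0) → Equiv.Perm (Level (shift q) n))
      (L' : ZMod (q 0) → ∀ i, ZMod (shift q i)),
      (∀ u, HasLabelSums (shift q) n (s u) (L' u)) ∧ g = node t s ∧ L 0 = t ∧
        ∀ i, L (i + 1) = ∑ c ∈ Finset.range (q 0), L' (c : ZMod (q 0)) i

namespace HasLabelSums

variable {q : ℕ → ℕ} {n : ℕ}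

theorem one (q : ℕ → ℕ) (n : ℕ) : HasLabelSums q n 1 0 := by
  induction n generalizing q with
  | zero => rfl
  | succ n ih =>
    exact ⟨0, 1, 0, fun u => ih (shift q), node_zero_one.symm, rfl,
      fun i => (Finset.sum_eq_zero fun _ _ => rfl).symm⟩

theorem mul (hq : ∀ i, q i ≠ 0) {g g' : Equiv.Perm (Level q n)} {L L' : ∀ i, ZMod (q i)}
    (h : HasLabelSums q n g L) (h' : HasLabelSums q n g' L') :
    HasLabelSums q n (g * g') (L + L') := by
  induction n generalizing q with
  | zero =>
    change L = 0 at h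
    change L' = 0 at h'
    change L + L' = 0
    rw [h, h', add_zero]
  | succ n ih =>
    have : NeZero (q 0) := ⟨hq 0⟩
    obtain ⟨t, s, M, hs, rfl, h0, hL⟩ := h
    obtain ⟨t', s', M', hs', rfl, h0', hL'⟩ := h'
    refine ⟨t + t', _, fun u => M (u + t') + M' u,
      fun u => ih (fun i => hq (i + 1)) (hs (u + t')) (hs' u), node_mul _ _ _ _,
      by rw [Pi.add_apply, h0, h0'], fun i => ?_⟩
    rw [Pi.add_apply, hL, hL']
    simp only [Pi.add_apply]
    rw [Finset.sum_add_distrib, sum_range_natCast_zmod fun u => M (u + t') i,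
      sum_range_natCast_zmod fun u => M u i,
      Fintype.sum_equiv (Equiv.addRight t') (fun u => M (u + t') i) (fun u => M u i) fun _ => rfl]
    rfl

theorem inv (hq : ∀ i, q i ≠ 0) {g : Equiv.Perm (Level q n)} {L : ∀ i, ZMod (q i)}
    (h : HasLabelSums q n g L) : HasLabelSums q n g⁻¹ (-L) := by
  induction n generalizing q with
  | zero =>
    change L = 0 at h
    change -L = 0
    rw [h, neg_zero]
  | succ n ih =>
    have : NeZero (q 0) := ⟨hq 0⟩
    obtain ⟨t, s, M, hs, rfl, h0, hL⟩ := h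
    refine ⟨-t, _, fun u => -M (u - t), fun u => ih (fun i => hq (i + 1)) (hs (u - t)),
      node_inv _ _, by rw [Pi.neg_apply, h0], fun i => ?_⟩
    rw [Pi.neg_apply, hL]
    simp only [Pi.neg_apply]
    rw [Finset.sum_neg_distrib, sum_range_natCast_zmod fun u => M (u - t) i,
      sum_range_natCast_zmod fun u => M u i,
      Fintype.sum_equiv (Equiv.subRight t) (fun u => M (u - t) i) (fun u => M u i) fun _ => rfl]
    rfl

theorem zpow (hq : ∀ i, q i ≠ 0) {g : Equiv.Perm (Level q n)} {L : ∀ i, ZMod (q i)}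
    (h : HasLabelSums q n g L) (c : ℤ) : HasLabelSums q n (g ^ c) (c • L) := by
  induction c using Int.induction_on with
  | zero => simpa using one q n
  | succ c ih => rw [zpow_add_one, add_zsmul, one_zsmul]; exact ih.mul hq h
  | pred c ih =>
    rw [zpow_sub_one, sub_eq_add_neg, add_zsmul, neg_one_zsmul]; exact ih.mul hq (h.inv hq)

theorem unique {g : Equiv.Perm (Level q n)} {L L' : ∀ i, ZMod (q i)}
    (h : HasLabelSums q n g L) (h' : HasLabelSums q n g L') : L = L' := by
  induction n generalizing q with
  | zero => exact Eq.trans h (Eq.symm h')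
  | succ n ih =>
    obtain ⟨t, s, M, hs, rfl, h0, hL⟩ := h
    obtain ⟨t', s', M', hs', hg, h0', hL'⟩ := h'
    obtain ⟨rfl, rfl⟩ := node_inj.1 hg
    have hM : M = M' := funext fun u => ih (hs u) (hs' u)
    funext i
    cases i with
    | zero => rw [h0, h0']
    | succ i => rw [hL, hL', hM]

theorem pathProd (hq : ∀ i, q i ≠ 0) {t : ZMod (q 0)}
    {s : ZMod (q 0) → Equiv.Perm (Level (shift q) n)} {L : ZMod (q 0) → ∀ i, ZMod (shift q i)}
    (h : ∀ u, HasLabelSums (shift q) n (s u) (L u)) (c : ℕ) (u : ZMod (q 0)) :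
    HasLabelSums (shift q) n (GrowingGGS.pathProd t s c u)
      (∑ d ∈ Finset.range c, L (u + (d : ZMod (q 0)) * t)) := by
  induction c with
  | zero => exact one _ _
  | succ c ih =>
    rw [Finset.sum_range_succ, add_comm (Finset.sum _ _)]
    exact (h _).mul (fun i => hq (i + 1)) ih

theorem pow_prod_eq_one (hq : ∀ i, q i ≠ 0) {g : Equiv.Perm (Level q n)} {L : ∀ i, ZMod (q i)}
    (h : HasLabelSums q n g L) : g ^ (∏ i ∈ Finset.range n, q i) = 1 := by
  induction n generalizing q with
  | zero => exact Subsingleton.elim (α := Equiv.Perm Unit) _ _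
  | succ n ih =>
    obtain ⟨t, s, M, hs, rfl, -, -⟩ := h
    rw [Finset.prod_range_succ', mul_comm, pow_mul, node_pow, CharP.cast_eq_zero, zero_mul,
      node_zero_pow, node_eq_one]
    refine ⟨rfl, funext fun u => ?_⟩
    exact ih (fun i => hq (i + 1)) (HasLabelSums.pathProd hq hs _ u)

end HasLabelSums

/-- The permutation of level `n + 1` that adds `c` to the last letter. -/
def lastRot : (q : ℕ → ℕ) → (n : ℕ) → ZMod (q n) → Equiv.Perm (Level q (n + 1))
  | q, 0, c => node (q := q) (n := 0) c 1
  | q, n + 1, c => node 0 fun _ => lastRot (shift q) n c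

theorem lastRot_nsmul (q : ℕ → ℕ) (n : ℕ) (c : ZMod (q n)) (d : ℕ) :
    lastRot q n (d * c) = lastRot q n c ^ d := by
  induction n generalizing q with
  | zero =>
    refine Eq.trans (node_inj.2 ⟨rfl, ?_⟩) (node_pow (q := q) (n := 0) c 1 d).symm
    exact funext fun u => Subsingleton.elim (α := Equiv.Perm Unit) _ _
  | succ n ih =>
    refine Eq.trans (node_inj.2 ⟨rfl, ?_⟩) (node_zero_pow (q := q) _ d).symm
    exact funext fun u => ih (shift q) c

theorem lastRot_eq_one {q : ℕ → ℕ} {n : ℕ} {c : ZMod (q n)} : lastRot q n c = 1 ↔ c = 0 := by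
  induction n generalizing q with
  | zero =>
    refine node_eq_one.trans (and_iff_left rfl)
  | succ n ih =>
    refine node_eq_one.trans ⟨fun h => ih.1 (congrFun h.2 0), fun h => ⟨rfl, funext fun _ => ?_⟩⟩
    exact ih.2 h

theorem HasLabelSums.commute_lastRot {q : ℕ → ℕ} {n : ℕ} {g : Equiv.Perm (Level q (n + 1))}
    {L : ∀ i, ZMod (q i)} (h : HasLabelSums q (n + 1) g L) (c : ZMod (q n)) :
    Commute g (lastRot q n c) := by
  induction n generalizing q with
  | zero =>
    obtain ⟨t, s, -, -, rfl, -, -⟩ := h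
    exact commute_node_iff.2 fun u => Subsingleton.elim (α := Equiv.Perm Unit) _ _
  | succ n ih =>
    obtain ⟨t, s, M, hs, rfl, -, -⟩ := h
    refine commute_node_iff.2 fun u => ?_
    rw [add_zero]
    exact ih (hs u) c

/-- If all label sums above the last level are units, then `g` permutes the vertices of each of
these levels cyclically, so the stated power of `g` collects at every vertex of length `n` the
labels of all of them. -/
theorem HasLabelSums.pow_prod_eq_lastRot {q : ℕ → ℕ} {n : ℕ} (hq : ∀ i, q i ≠ 0)
    {g : Equiv.Perm (Level q (n + 1))}
    {L : ∀ i, ZMod (q i)} (h : HasLabelSums q (n + 1) g L) (hL : ∀ i < n, IsUnit (L i)) :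
    g ^ (∏ i ∈ Finset.range n, q i) = lastRot q n (L n) := by
  induction n generalizing q with
  | zero =>
    obtain ⟨t, s, -, -, rfl, rfl, -⟩ := h
    rw [Finset.prod_range_zero, pow_one]
    exact node_inj.2 ⟨rfl, funext fun u => Subsingleton.elim (α := Equiv.Perm Unit) _ _⟩
  | succ n ih =>
    have : NeZero (q 0) := ⟨hq 0⟩
    obtain ⟨t, s, M, hs, rfl, rfl, h1⟩ := h
    rw [Finset.prod_range_succ', mul_comm, pow_mul, node_pow, CharP.cast_eq_zero, zero_mul,
      node_zero_pow]
    refine node_inj.2 ⟨rfl, funext fun u => ?_⟩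
    have hM : ∀ i, (∑ d ∈ Finset.range (q 0), M (u + (d : ZMod (q 0)) * L 0)) i = L (i + 1) := by
      intro i
      rw [Finset.sum_apply, h1, sum_range_orbit (fun v => M v i) u (hL 0 n.succ_pos),
        sum_range_natCast_zmod fun v => M v i]
    have := ih (fun i => hq (i + 1)) (HasLabelSums.pathProd hq hs _ u)
      (fun i hi => by rw [hM]; exact hL (i + 1) (Nat.succ_lt_succ hi))
    rw [hM] at this
    exact this

variable {q : ℕ → ℕ} {n k : ℕ} {e : ℕ → ℤ}

theorem sum_sectionExp [NeZero (q 0)] (hk : 0 < k) (hkq : k ≤ q 0) :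
    ∑ u : ZMod (q 0), sectionExp k e u = ∑ i ∈ Finset.Icc 1 (k - 1), e i := by
  rw [← sum_range_natCast_zmod fun u : ZMod (q 0) => sectionExp k e u]
  have hval : ∀ c ∈ Finset.range (q 0), (c : ZMod (q 0)).val = c := fun c hc =>
    ZMod.val_cast_of_lt (Finset.mem_range.1 hc)
  symm
  refine Finset.sum_subset_zero_on_sdiff (fun i hi => ?_) (fun i hi => ?_) (fun i hi => ?_)
  · rw [Finset.mem_Icc] at hi
    exact Finset.mem_range.2 (by omega)
  · rw [Finset.mem_sdiff, Finset.mem_Icc] at hi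
    have h0 : (i : ZMod (q 0)) = 0 ↔ i = 0 := by rw [← ZMod.val_eq_zero, hval i hi.1]
    simp only [sectionExp, h0, hval i hi.1]
    split_ifs
    · rfl
    · omega
    · rfl
  · rw [Finset.mem_Icc] at hi
    have hi' := hval i (Finset.mem_range.2 (by omega))
    have h0 : (i : ZMod (q 0)) = 0 ↔ i = 0 := by rw [← ZMod.val_eq_zero, hi']
    simp only [sectionExp, h0, hi']
    rw [if_neg (by omega), if_pos (by omega)]

theorem sectionExp_natCast {r : ℕ} (hr : 0 < r) (hrk : r < k) (hk : k ≤ q 0) :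
    (r : ZMod (q 0)) ≠ 0 ∧ sectionExp k e (r : ZMod (q 0)) = e r := by
  have hval : (r : ZMod (q 0)).val = r := ZMod.val_cast_of_lt (hrk.trans_le hk)
  have h0 : (r : ZMod (q 0)) ≠ 0 := fun h => by
    rw [h, ZMod.val_zero] at hval
    omega
  exact ⟨h0, by rw [sectionExp, if_neg h0, hval, if_pos hrk]⟩

theorem exists_hasLabelSums_rootedLevel (q : ℕ → ℕ) (n : ℕ) :
    ∃ L, HasLabelSums q (n + 1) (rootedLevel q (n + 1)) L ∧ L 0 = 1 ∧ ∀ i, L (i + 1) = 0 :=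
  ⟨fun i => match i with
    | 0 => 1
    | _ + 1 => 0,
    ⟨1, 1, 0, fun _ => .one _ _, rfl, rfl, fun _ => (Finset.sum_eq_zero fun _ _ => rfl).symm⟩,
    rfl, fun _ => rfl⟩

theorem exists_hasLabelSums_directedLevel (hk : 0 < k) (hkq : ∀ i, k ≤ q i) (n : ℕ) :
    ∃ L, HasLabelSums q (n + 1) (directedLevel k e q (n + 1)) L ∧ L 0 = 0 ∧
      ∀ i < n, L (i + 1) = ((∑ i ∈ Finset.Icc 1 (k - 1), e i : ℤ) : ZMod (q (i + 1))) := by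
  have hq : ∀ i, q i ≠ 0 := fun i => (hk.trans_le (hkq i)).ne'
  induction n generalizing q with
  | zero => exact ⟨0, directedLevel_one k e ▸ .one _ _, rfl, fun i hi => absurd hi i.not_lt_zero⟩
  | succ n ih =>
    have : NeZero (q 0) := ⟨hq 0⟩
    obtain ⟨M, hM, hM0, hM1⟩ := ih (q := shift q) (fun i => hkq (i + 1)) fun i => hq (i + 1)
    obtain ⟨A, hA, hA0, hA1⟩ := exists_hasLabelSums_rootedLevel (shift q) n
    let L' : ZMod (q 0) → ∀ i, ZMod (shift q i) :=
      fun u => if u = 0 then M else sectionExp k e u • A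
    refine ⟨fun i => match i with
      | 0 => 0
      | i + 1 => ∑ c ∈ Finset.range (q 0), L' (c : ZMod (q 0)) i,
      ⟨0, _, L', fun u => ?_, directedLevel_succ k e, rfl, fun i => rfl⟩, rfl, fun i hi => ?_⟩
    · change HasLabelSums _ _ (if u = 0 then _ else _) (if u = 0 then M else _)
      by_cases hu : u = 0
      · rw [if_pos hu, if_pos hu]
        exact hM
      · rw [if_neg hu, if_neg hu]
        exact hA.zpow (fun i => hq (i + 1)) _
    · change ∑ c ∈ Finset.range (q 0), L' (c : ZMod (q 0)) i = _
      rw [sum_range_natCast_zmod fun u => L' u i]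
      cases i with
      | zero =>
        have : ∀ u, L' u 0 = ((sectionExp k e u : ℤ) : ZMod (shift q 0)) := by
          intro u
          by_cases hu : u = 0
          · simp only [L', if_pos hu, hM0]
            rw [hu, sectionExp_zero, Int.cast_zero]
          · simp only [L', if_neg hu, Pi.smul_apply, hA0, zsmul_one]
        rw [Finset.sum_congr rfl fun u _ => this u, ← Int.cast_sum, sum_sectionExp hk (hkq 0)]
        rfl
      | succ i =>
        rw [Fintype.sum_eq_single (0 : ZMod (q 0)) fun u hu => ?_]
        · simp only [L', if_true]
          exact hM1 i (Nat.lt_of_succ_lt_succ hi)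
        · simp only [L', if_neg hu, Pi.smul_apply, hA1, smul_zero]

/-! ### Orders and commutation on finite levels -/

theorem zmod_induction_of_isUnit {N : ℕ} [NeZero N] {P : ZMod N → Prop} {t : ZMod N}
    (ht : IsUnit t) (h0 : P 0) (h : ∀ u, P u → P (u + t)) (u : ZMod N) : P u := by
  have key : ∀ c : ℕ, P ((c : ZMod N) * t) := by
    intro c
    induction c with
    | zero => simpa using h0
    | succ c ih => simpa [add_mul] using h _ ih
  obtain ⟨t, rfl⟩ := ht
  simpa using key (u * ↑t⁻¹).val

/-- Numerical conditions on a branching sequence `q` and a defining vector `e` of length `k - 1`: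
they hold for growing GGS-groups and are inherited by the subtrees. -/
structure IsAdmissible (q : ℕ → ℕ) (k : ℕ) (e : ℕ → ℤ) : Prop where
  one_lt : ∀ i, 1 < q i
  le : ∀ i, k ≤ q i
  dvd : ∀ i, q i ∣ q (i + 1)
  exists_coprime : ∃ r, 0 < r ∧ r < k ∧ ∀ i, IsCoprime (q i : ℤ) (e r)

namespace IsAdmissible

theorem shift (h : IsAdmissible q k e) : IsAdmissible (shift q) k e where
  one_lt i := h.one_lt (i + 1)
  le i := h.le (i + 1)
  dvd i := h.dvd (i + 1)
  exists_coprime := h.exists_coprime.imp fun _ hr => ⟨hr.1, hr.2.1, fun i => hr.2.2 (i + 1)⟩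

theorem ne_zero (h : IsAdmissible q k e) (i : ℕ) : q i ≠ 0 := (h.one_lt i).ne_bot

theorem pos (h : IsAdmissible q k e) : 0 < k := by
  obtain ⟨r, h0, hr, -⟩ := h.exists_coprime
  exact h0.trans hr

theorem dvd_of_le (h : IsAdmissible q k e) {i j : ℕ} (hij : i ≤ j) : q i ∣ q j :=
  Nat.le_induction dvd_rfl (fun j _ ih => ih.trans (h.dvd j)) j hij

end IsAdmissible

theorem rootedLevel_zpow_eq_one {c : ℤ} : rootedLevel q (n + 1) ^ c = 1 ↔ (q 0 : ℤ) ∣ c := by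
  rw [rootedLevel_zpow, node_eq_one, and_iff_left rfl, ZMod.intCast_zmod_eq_zero_iff_dvd]

/-- A power of the directed automorphism that is conjugate to a power of the rooted one is
trivial, since the directed automorphism fixes the first level. -/
theorem directedLevel_zpow_eq_one_of_semiconjBy {c d : ℤ} {g : Equiv.Perm (Level q n)}
    {L : ∀ i, ZMod (q i)} (hg : HasLabelSums q n g L)
    (h : SemiconjBy g (directedLevel k e q n ^ c) (rootedLevel q n ^ d)) :
    directedLevel k e q n ^ c = 1 := by
  cases n with
  | zero => exact Subsingleton.elim (α := Equiv.Perm Unit) _ _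
  | succ n =>
    obtain ⟨t, s, -, -, rfl, -, -⟩ := hg
    have h' := h
    rw [rootedLevel_zpow, directedLevel_zpow, SemiconjBy, node_mul, node_mul, node_inj] at h'
    have hd : (d : ZMod (q 0)) = 0 := by simpa using h'.1
    rw [rootedLevel_zpow, hd, node_zero_one] at h
    rw [SemiconjBy, one_mul] at h
    exact mul_eq_left.1 h

theorem directedLevel_zpow_eq_one_of_sections {c : ℤ}
    (h0 : directedLevel k e (shift q) n ^ c = 1)
    (h1 : ∀ u : ZMod (q 0), rootedLevel (shift q) n ^ (sectionExp k e u * c) = 1) :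
    directedLevel k e q (n + 1) ^ c = 1 := by
  rw [directedLevel_zpow, node_eq_one]
  refine ⟨rfl, funext fun u => ?_⟩
  rw [h0, h1, ite_self]
  rfl

/-- If a power of the directed automorphism commutes with the rooted one, all its sections are
equal, so its directed section is a power of the rooted automorphism. -/
theorem directedLevel_zpow_eq_one_of_commute (h : 1 < q 0) {c : ℤ}
    (hc : Commute (rootedLevel q n) (directedLevel k e q n ^ c)) :
    directedLevel k e q n ^ c = 1 := by
  cases n with
  | zero => exact Subsingleton.elim (α := Equiv.Perm Unit) _ _
  | succ n =>
    have : NeZero (q 0) := ⟨h.ne_bot⟩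
    have : Fact (1 < q 0) := ⟨h⟩
    rw [rootedLevel_succ, directedLevel_zpow, commute_node_iff] at hc
    have h0 : directedLevel k e (shift q) n ^ c = 1 := by
      have h01 := hc 0
      simp only [Pi.one_apply, one_mul, mul_one, zero_add, if_true, one_ne_zero, if_false] at h01
      refine directedLevel_zpow_eq_one_of_semiconjBy (.one _ _)
        (d := sectionExp k e (1 : ZMod (q 0)) * c) ?_
      rw [SemiconjBy, one_mul, mul_one]
      exact h01
    rw [directedLevel_zpow, node_eq_one]
    refine ⟨rfl, funext fun u => zmod_induction_of_isUnit (P := fun u => (if u = 0 then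
      directedLevel k e (shift q) n ^ c else rootedLevel (shift q) n ^ (sectionExp k e u * c)) = 1)
      isUnit_one ?_ (fun u hu => ?_) u⟩
    · rw [if_pos rfl, h0]
    · have := hc u
      simp only [Pi.one_apply, one_mul, mul_one] at this hu
      exact this.symm.trans hu

theorem dvd_of_directedLevel_zpow_eq_one (h : IsAdmissible q k e) {c : ℤ}
    (hc : directedLevel k e q (n + 2) ^ c = 1) : (q (n + 1) : ℤ) ∣ c := by
  induction n generalizing q with
  | zero =>
    obtain ⟨r, h0, hr, hcop⟩ := h.exists_coprime
    obtain ⟨hr0, hre⟩ := sectionExp_natCast (e := e) h0 hr (h.le 0)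
    rw [directedLevel_zpow, node_eq_one] at hc
    have := congrFun hc.2 (r : ZMod (q 0))
    rw [if_neg hr0, hre, Pi.one_apply, rootedLevel_zpow_eq_one] at this
    exact (hcop 1).dvd_of_dvd_mul_left this
  | succ n ih =>
    rw [directedLevel_zpow, node_eq_one] at hc
    have := congrFun hc.2 0
    rw [if_pos rfl] at this
    exact ih h.shift this

theorem directedLevel_zpow_eq_one_of_shift (h : IsAdmissible q k e) {c : ℤ}
    (hc : directedLevel k e (shift q) (n + 2) ^ c = 1) :
    directedLevel k e q (n + 3) ^ c = 1 := by
  refine directedLevel_zpow_eq_one_of_sections hc fun u => rootedLevel_zpow_eq_one.2 ?_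
  refine Dvd.dvd.mul_left (dvd_trans ?_ (dvd_of_directedLevel_zpow_eq_one h.shift hc)) _
  exact_mod_cast h.dvd_of_le (Nat.le_add_left 1 (n + 1))

theorem directedLevel_ne_one (h : IsAdmissible q k e) : directedLevel k e q (n + 2) ≠ 1 := by
  intro h1
  have := dvd_of_directedLevel_zpow_eq_one (n := n) (c := 1) h (by rw [zpow_one, h1])
  have := Int.le_of_dvd one_pos this
  have := h.one_lt (n + 1)
  omega

theorem rootedLevel_mul_directedLevel_zpow (i j : ℤ) :
    rootedLevel q (n + 1) ^ i * directedLevel k e q (n + 1) ^ j =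
      node (i : ZMod (q 0)) fun u => if u = 0 then directedLevel k e (shift q) n ^ j
        else rootedLevel (shift q) n ^ (sectionExp k e u * j) := by
  rw [rootedLevel_zpow, directedLevel_zpow, node_mul, node_inj]
  exact ⟨add_zero _, funext fun u => one_mul _⟩

/-- When the defining vector sums to zero, the contributions of the rooted automorphism cancel
along the orbit of the last letter. -/
theorem exists_pow_eq_node [NeZero (q 0)] (hk : 0 < k) (hkq : k ≤ q 0)
    (hsum : ∑ i ∈ Finset.Icc 1 (k - 1), e i = 0) {i : ℤ} (hi : IsUnit (i : ZMod (q 0))) (j : ℤ) :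
    ∃ s, (rootedLevel q (n + 1) ^ i * directedLevel k e q (n + 1) ^ j) ^ q 0 = node 0 s ∧
      s 0 = directedLevel k e (shift q) n ^ j := by
  rw [rootedLevel_mul_directedLevel_zpow, node_pow, CharP.cast_eq_zero, zero_mul]
  refine ⟨_, rfl, ?_⟩
  have key : ∀ c, c < q 0 →
      pathProd (i : ZMod (q 0)) (fun u => if u = 0 then directedLevel k e (shift q) n ^ j
        else rootedLevel (shift q) n ^ (sectionExp k e u * j)) (c + 1) 0 =
      rootedLevel (shift q) n ^ ((∑ d ∈ Finset.range (c + 1),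
        sectionExp k e (0 + (d : ZMod (q 0)) * (i : ZMod (q 0)))) * j) *
          directedLevel k e (shift q) n ^ j := by
    intro c
    induction c with
    | zero =>
      intro _
      simp [pathProd, sectionExp_zero]
    | succ c ih =>
      intro hc
      have hne : (0 + ((c + 1 : ℕ) : ZMod (q 0)) * (i : ZMod (q 0))) ≠ 0 := by
        rw [zero_add]
        intro h0
        rw [hi.mul_left_eq_zero, ZMod.natCast_eq_zero_iff] at h0
        exact absurd (Nat.le_of_dvd c.succ_pos h0) (by omega)
      rw [pathProd, ih (by omega), if_neg hne, ← mul_assoc, ← zpow_add,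
        Finset.sum_range_succ _ (c + 1), add_comm (_ * j), ← add_mul]
  obtain ⟨c, hc⟩ := Nat.exists_eq_succ_of_ne_zero (NeZero.ne (q 0))
  have := key c (by omega)
  rw [← Nat.succ_eq_add_one, ← hc,
    sum_range_orbit (fun v => sectionExp k e v) (0 : ZMod (q 0)) hi,
    sum_sectionExp hk hkq, hsum, zero_mul, zpow_zero, one_mul] at this
  exact this

theorem dvd_of_node_zpow_eq {i : ZMod (q 0)} (hi : IsUnit i)
    {s s' : ZMod (q 0) → Equiv.Perm (Level (shift q) n)} {c : ℤ}
    (h : node i s ^ c = node 0 s') : (q 0 : ℤ) ∣ c := by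
  obtain ⟨s'', hs⟩ := exists_node_zpow i s c
  rw [hs, node_inj, hi.mul_left_eq_zero, ZMod.intCast_zmod_eq_zero_iff_dvd] at h
  exact h.1

/-- The order of `a ^ i * b ^ j` does not depend on the unit `i`. -/
theorem rooted_mul_directed_zpow_eq_one [NeZero (q 0)] (hk : 0 < k) (hkq : k ≤ q 0)
    (hsum : ∑ i ∈ Finset.Icc 1 (k - 1), e i = 0) {i : ℤ} (hi : IsUnit (i : ZMod (q 0)))
    (j c : ℤ) : (rootedLevel q (n + 1) ^ i * directedLevel k e q (n + 1) ^ j) ^ c = 1 ↔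
      ∃ d, c = q 0 * d ∧ directedLevel k e (shift q) n ^ (j * d) = 1 := by
  obtain ⟨s, hs, hs0⟩ := exists_pow_eq_node (n := n) hk hkq hsum hi j
  have hpow : ∀ d : ℤ, (rootedLevel q (n + 1) ^ i * directedLevel k e q (n + 1) ^ j) ^
      ((q 0 : ℤ) * d) = node 0 (s ^ d) := fun d => by
    rw [zpow_mul, zpow_natCast, hs, node_zero_zpow]
  constructor
  · intro h
    have hdvd : (q 0 : ℤ) ∣ c := by
      rw [rootedLevel_mul_directedLevel_zpow, ← node_zero_one] at h
      exact dvd_of_node_zpow_eq hi h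
    obtain ⟨d, rfl⟩ := hdvd
    rw [hpow, node_eq_one] at h
    refine ⟨d, rfl, ?_⟩
    rw [zpow_mul, ← hs0]
    exact congrFun h.2 0
  · rintro ⟨d, rfl, hd⟩
    have hcomm : Commute (rootedLevel q (n + 1) ^ i * directedLevel k e q (n + 1) ^ j)
        (node 0 (s ^ d)) := by
      rw [← hpow]
      exact (Commute.refl _).zpow_right _
    rw [rootedLevel_mul_directedLevel_zpow, commute_node_iff] at hcomm
    rw [hpow, node_eq_one]
    refine ⟨rfl, funext fun u =>
      zmod_induction_of_isUnit (P := fun u => (s ^ d) u = 1) hi ?_ (fun u hu => ?_) u⟩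
    · rw [Pi.pow_apply, hs0, ← zpow_mul, hd]
    · have := hcomm u
      rw [hu, add_zero, mul_one] at this
      exact mul_eq_right.1 this.symm

theorem rooted_commute_of_commute_zpow {r : ℕ} (hcop : IsCoprime (q 0 : ℤ) (e r))
    {g : Equiv.Perm (Level q n)}
    (hg : Commute g (rootedLevel q n ^ e r)) : Commute g (rootedLevel q n) := by
  cases n with
  | zero => exact Subsingleton.elim (α := Equiv.Perm Unit) _ _
  | succ n =>
    obtain ⟨x, y, hxy⟩ := hcop
    have : rootedLevel q (n + 1) = (rootedLevel q (n + 1) ^ e r) ^ y := by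
      rw [← zpow_mul, ← mul_inv_eq_one, ← zpow_neg, ← zpow_one_add, rootedLevel_zpow_eq_one]
      exact ⟨x, by linear_combination -hxy⟩
    rw [this]
    exact hg.zpow_right y

/-- A central power of `a * b ^ j` is trivial on levels `≥ 3`: it fixes the first level, all its
sections equal a power of `b`, and this power commutes with `a`. -/
theorem rooted_mul_directed_zpow_eq_one_of_commute (h : IsAdmissible q k e)
    (hsum : ∑ i ∈ Finset.Icc 1 (k - 1), e i = 0) {j c : ℤ}
    {L : ∀ i, ZMod (q i)} (hL : HasLabelSums q (n + 3)
      ((rootedLevel q (n + 3) * directedLevel k e q (n + 3) ^ j) ^ c) L)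
    (ha : Commute ((rootedLevel q (n + 3) * directedLevel k e q (n + 3) ^ j) ^ c)
      (rootedLevel q (n + 3)))
    (hb : Commute ((rootedLevel q (n + 3) * directedLevel k e q (n + 3) ^ j) ^ c)
      (directedLevel k e q (n + 3))) :
    (rootedLevel q (n + 3) * directedLevel k e q (n + 3) ^ j) ^ c = 1 := by
  have : NeZero (q 0) := ⟨h.ne_zero 0⟩
  replace hb : Commute ((rootedLevel q (n + 3) * directedLevel k e q (n + 3) ^ j) ^ c)
      (directedLevel k e q (n + 3) ^ (1 : ℤ)) := by rwa [zpow_one (directedLevel k e q (n + 3))]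
  have hunit : IsUnit ((1 : ℤ) : ZMod (q 0)) := by rw [Int.cast_one]; exact isUnit_one
  -- A rotation by a nonzero amount would conjugate the directed section of the directed
  -- automorphism to a rooted one.
  have hdvd : (q 0 : ℤ) ∣ c := by
    obtain ⟨t, s, L', hs, hts, -, -⟩ := hL
    by_cases ht : t = 0
    · rw [ht] at hts
      rw [← zpow_one (rootedLevel q (n + 3)), rootedLevel_mul_directedLevel_zpow] at hts
      exact dvd_of_node_zpow_eq hunit hts
    · rw [hts, directedLevel_zpow, commute_node_iff] at hb
      have h0 := hb 0
      rw [zero_add, zero_add, if_neg ht, if_pos rfl] at h0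
      have := directedLevel_zpow_eq_one_of_semiconjBy (hs 0) h0
      rw [zpow_one] at this
      exact absurd this (directedLevel_ne_one h.shift)
  obtain ⟨d, rfl⟩ := hdvd
  have hpow := exists_pow_eq_node (n := n + 2) h.pos (h.le 0) hsum hunit j
  rw [zpow_one] at hpow
  obtain ⟨s, hs, hs0⟩ := hpow
  rw [zpow_mul, zpow_natCast, hs, node_zero_zpow] at ha hb ⊢
  have hconst : ∀ u, (s ^ d) u = (s ^ d) 0 := by
    rw [rootedLevel_succ, commute_node_iff] at ha
    refine zmod_induction_of_isUnit (P := fun u => (s ^ d) u = (s ^ d) 0) isUnit_one rfl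
      fun u hu => ?_
    have := ha u
    simp only [Pi.one_apply, one_mul, mul_one] at this
    exact this.trans hu
  obtain ⟨r, h0, hr, hcop⟩ := h.exists_coprime
  obtain ⟨hr0, hre⟩ := sectionExp_natCast (e := e) h0 hr (h.le 0)
  have hsd : (s ^ d) 0 = directedLevel k e (shift q) (n + 2) ^ (j * d) := by
    rw [Pi.pow_apply, hs0, zpow_mul]
  have hcomm : (s ^ d) 0 = 1 := by
    rw [directedLevel_zpow, commute_node_iff] at hb
    have := hb r
    rw [add_zero, if_neg hr0, hre, hconst, hsd, mul_one] at this
    rw [hsd]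
    exact directedLevel_zpow_eq_one_of_commute (h.one_lt 1)
      (rooted_commute_of_commute_zpow (hcop 1) this).symm
  rw [node_eq_one]
  exact ⟨rfl, funext fun u => (hconst u).trans hcomm⟩

/-! ### Conjugate powers of particular elements -/

/-- A power of the directed automorphism that commutes with an element moving the letters of the
first level is trivial. -/
theorem directedLevel_zpow_eq_one_of_commute_of_label_ne_zero (h : IsAdmissible q k e) {c : ℤ}
    {g : Equiv.Perm (Level q (n + 3))} {L : ∀ i, ZMod (q i)} (hL : HasLabelSums q (n + 3) g L)
    (hL0 : L 0 ≠ 0) (hc : Commute g (directedLevel k e q (n + 3) ^ c)) :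
    directedLevel k e q (n + 3) ^ c = 1 := by
  obtain ⟨t, s, L', hs, rfl, rfl, -⟩ := hL
  rw [directedLevel_zpow, commute_node_iff] at hc
  have h0 := hc 0
  rw [zero_add, zero_add, if_neg hL0, if_pos rfl] at h0
  exact directedLevel_zpow_eq_one_of_shift h (directedLevel_zpow_eq_one_of_semiconjBy (hs 0) h0)

/-- The order of `a * b ^ j` is so large that its powers of order dividing `q 0` fix the first
level, while a nontrivial power of `a` does not. -/
theorem rootedLevel_zpow_eq_one_of_semiconjBy (h : IsAdmissible q k e)
    (hsum : ∑ i ∈ Finset.Icc 1 (k - 1), e i = 0) {j : ℤ} (hj : (q 0 : ℤ) * j ∣ q (n + 2))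
    (hj0 : j ≠ 0) {c d : ℤ}
    {g : Equiv.Perm (Level q (n + 3))} {L : ∀ i, ZMod (q i)} (hL : HasLabelSums q (n + 3) g L)
    (hg : SemiconjBy g (rootedLevel q (n + 3) ^ c)
      ((rootedLevel q (n + 3) * directedLevel k e q (n + 3) ^ j) ^ d)) :
    rootedLevel q (n + 3) ^ c = 1 := by
  have : NeZero (q 0) := ⟨h.ne_zero 0⟩
  have hunit : IsUnit ((1 : ℤ) : ZMod (q 0)) := by rw [Int.cast_one]; exact isUnit_one
  have h1 : (rootedLevel q (n + 3) * directedLevel k e q (n + 3) ^ j) ^ (d * q 0) = 1 := by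
    have h2 := hg.pow_right (q 0)
    rw [← zpow_natCast, ← zpow_natCast, ← zpow_mul, ← zpow_mul,
      rootedLevel_zpow_eq_one.2 (dvd_mul_left _ c), SemiconjBy, mul_one] at h2
    exact mul_eq_right.1 h2.symm
  have h2 := rooted_mul_directed_zpow_eq_one (n := n + 2) h.pos (h.le 0) hsum hunit j (d * q 0)
  rw [zpow_one] at h2
  obtain ⟨d', hd', h3⟩ := h2.1 h1
  have hq0 : (q 0 : ℤ) ≠ 0 := by exact_mod_cast h.ne_zero 0
  obtain rfl : d = d' := mul_left_cancel₀ hq0 (by linear_combination hd')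
  have h4 : (q (n + 2) : ℤ) ∣ j * d := dvd_of_directedLevel_zpow_eq_one h.shift h3
  have h5 : (q 0 : ℤ) ∣ d := by
    refine (mul_dvd_mul_iff_left hj0).1 (dvd_trans ?_ h4)
    rwa [mul_comm]
  obtain ⟨t, s, L', hs, rfl, -, -⟩ := hL
  have h6 : rootedLevel q (n + 3) * directedLevel k e q (n + 3) ^ j = _ :=
    rootedLevel_mul_directedLevel_zpow 1 j
  rw [h6] at hg
  obtain ⟨s', hs'⟩ := exists_node_zpow ((1 : ℤ) : ZMod (q 0)) (fun u =>
    if u = 0 then directedLevel k e (shift q) (n + 2) ^ j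
        else rootedLevel (shift q) (n + 2) ^ (sectionExp k e u * j)) d
  rw [hs', rootedLevel_zpow, SemiconjBy, node_mul, node_mul, node_inj] at hg
  rw [rootedLevel_zpow_eq_one, ← ZMod.intCast_zmod_eq_zero_iff_dvd]
  have hd0 : (d : ZMod (q 0)) = 0 := (ZMod.intCast_zmod_eq_zero_iff_dvd _ _).2 h5
  simpa [hd0] using hg.1

theorem mul_zpow_eq_one_comm {G : Type*} [Group G] {x y : G} {d : ℤ} (h : (x * y) ^ d = 1) :
    (y * x) ^ d = 1 := by
  have : y * x = x⁻¹ * (x * y) * x⁻¹⁻¹ := by group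
  rw [this, conj_zpow, h]
  group

/-- On the tree with three vertices of length one, the element `b * (a * b * a⁻¹)` has sections
`b * a ^ e₂`, `a ^ e₁ * b` and `1` at the letters `0`, `1`, `2`, of which the first two have the
same order, whereas a power of `b` of order `p` has only one nontrivial section. -/
theorem directedLevel_zpow_eq_one_of_semiconjBy_mul_conj (h : IsAdmissible q 3 e) (hq0 : q 0 = 3)
    (hsum : ∑ i ∈ Finset.Icc 1 (3 - 1), e i = 0) (hcop : ∀ i, IsCoprime (q i : ℤ) (e 1))
    {c d : ℤ} {f : Equiv.Perm (Level q (n + 3))} {L : ∀ i, ZMod (q i)}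
    (hL : HasLabelSums q (n + 3) f L)
    (hf : SemiconjBy f ((directedLevel 3 e q (n + 3) *
      (rootedLevel q (n + 3) * directedLevel 3 e q (n + 3) * (rootedLevel q (n + 3))⁻¹)) ^ d)
      (directedLevel 3 e q (n + 3) ^ c)) :
    directedLevel 3 e q (n + 3) ^ c = 1 := by
  have : NeZero (shift q 0) := ⟨h.ne_zero 1⟩
  have he2 : e 2 = -e 1 := by
    have : Finset.Icc 1 (3 - 1) = {1, 2} := by decide
    rw [this, Finset.sum_pair (by decide)] at hsum
    omega
  set B : ZMod (q 0) → Equiv.Perm (Level (shift q) (n + 2)) := fun u =>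
    if u = 0 then directedLevel 3 e (shift q) (n + 2)
      else rootedLevel (shift q) (n + 2) ^ sectionExp 3 e u with hB
  have hy : directedLevel 3 e q (n + 3) *
      (rootedLevel q (n + 3) * directedLevel 3 e q (n + 3) * (rootedLevel q (n + 3))⁻¹) =
      node 0 fun u => B u * B (u - 1) := by
    rw [directedLevel_succ, ← hB, rootedLevel_succ, node_inv, node_mul, node_mul, node_mul, node_inj]
    exact ⟨by simp, by funext u; simp [sub_eq_add_neg]⟩
  have h1 := sectionExp_natCast (q := q) (e := e) (r := 1) (by decide) (by decide) (h.le 0)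
  have h2 := sectionExp_natCast (q := q) (e := e) (r := 2) (by decide) (by decide) (h.le 0)
  rw [Nat.cast_one] at h1
  rw [Nat.cast_two, he2] at h2
  have hB0 : B 0 = directedLevel 3 e (shift q) (n + 2) := if_pos rfl
  have hB1 : B 1 = rootedLevel (shift q) (n + 2) ^ e 1 := by rw [hB]; simp only [h1, if_false]
  have hB2 : B 2 = rootedLevel (shift q) (n + 2) ^ (-e 1) := by rw [hB]; simp only [h2, if_false]
  have hcases : ∀ u : ZMod (q 0), u = 0 ∨ u = 1 ∨ u = 2 := by rw [hq0]; decide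
  have h01 : (0 - 1 : ZMod (q 0)) = 2 := by rw [hq0]; decide
  have h21 : (2 - 1 : ZMod (q 0)) = 1 := by rw [hq0]; decide
  have h12 : (2 + 1 : ZMod (q 0)) = 0 := by rw [hq0]; decide
  have h22 : (2 + 2 : ZMod (q 0)) = 1 := by rw [hq0]; decide
  obtain ⟨t, s, L', hs, rfl, -, -⟩ := hL
  rw [hy, node_zero_zpow, directedLevel_succ, node_zero_zpow, SemiconjBy, node_mul, node_mul,
    node_inj, ← hB] at hf
  have hsec : ∀ u, SemiconjBy (s u) ((B u * B (u - 1)) ^ d) (B (u + t) ^ c) := fun u => by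
    have := congrFun hf.2 u
    rw [add_zero] at this
    exact this
  have hw2 : B 2 * B (2 - 1) = 1 := by rw [h21, hB1, hB2, ← zpow_add, neg_add_cancel, zpow_zero]
  have ht2 : B (2 + t) ^ c = 1 := by
    have := hsec 2
    rw [hw2, one_zpow, SemiconjBy, mul_one] at this
    exact mul_eq_right.1 this.symm
  -- The sections at the letters `0` and `1` vanish to the same powers.
  have hiff : (B 0 * B (0 - 1)) ^ d = 1 ↔ (B 1 * B (1 - 1)) ^ d = 1 := by
    have hu : IsUnit ((e 1 : ℤ) : ZMod (shift q 0)) :=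
      ((ZMod.coe_int_isUnit_iff_isCoprime _ _).2 (hcop 1))
    have hu' : IsUnit ((-e 1 : ℤ) : ZMod (shift q 0)) := by
      rw [Int.cast_neg]
      exact hu.neg
    have k1 := rooted_mul_directed_zpow_eq_one (n := n + 1) h.pos (h.le 1) hsum hu 1 d
    have k2 := rooted_mul_directed_zpow_eq_one (n := n + 1) h.pos (h.le 1) hsum hu' 1 d
    rw [zpow_one (directedLevel 3 e (GrowingGGS.shift q) (n + 1 + 1))] at k1 k2
    rw [h01, sub_self, hB0, hB1, hB2]
    exact ⟨fun hd => k1.2 (k2.1 (mul_zpow_eq_one_comm hd)),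
      fun hd => mul_zpow_eq_one_comm (k2.2 (k1.1 hd))⟩
  have hfinish : (B 0 * B (0 - 1)) ^ d = 1 → directedLevel 3 e q (n + 3) ^ c = 1 := by
    intro hd
    rw [directedLevel_succ, ← hB, node_zero_zpow, node_eq_one]
    refine ⟨rfl, funext fun v => ?_⟩
    have hv : (B (v - t) * B (v - t - 1)) ^ d = 1 := by
      rcases hcases (v - t) with hu | hu | hu <;> rw [hu]
      · exact hd
      · exact hiff.1 hd
      · rw [hw2, one_zpow]
    have := hsec (v - t)
    rw [hv, sub_add_cancel, SemiconjBy, mul_one] at this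
    exact mul_eq_right.1 this.symm
  rcases hcases t with rfl | rfl | rfl
  · refine hfinish (hiff.2 ?_)
    have := hsec 1
    rw [add_zero] at this ht2
    have hB1c : B 1 ^ c = 1 := by rw [hB1, ← inv_eq_one, ← inv_zpow, ← zpow_neg, ← hB2, ht2]
    rw [hB1c, SemiconjBy, one_mul] at this
    exact mul_eq_left.1 this
  · rw [h12, hB0] at ht2
    exact directedLevel_zpow_eq_one_of_shift h ht2
  · refine hfinish ?_
    have := hsec 0
    rw [h22] at ht2
    have hB2c : B (0 + 2) ^ c = 1 := by
      rw [zero_add, hB2, ← inv_eq_one, ← inv_zpow, ← zpow_neg, neg_neg, ← hB1, ht2]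
    rw [hB2c, SemiconjBy, one_mul] at this
    exact mul_eq_left.1 this

/-! ### Beauville structures in finite `p`-groups -/

section Groups

variable {Q : Type*} [Group Q]

/-- The image of `x` in the abelianization is that of `a ^ i * b ^ j`. -/
def HasExponents (a b x : Q) (i j : ℤ) : Prop :=
  Abelianization.of x = Abelianization.of a ^ i * Abelianization.of b ^ j

namespace HasExponents

variable {a b x y : Q} {i j i' j' : ℤ}

theorem left (a b : Q) : HasExponents a b a 1 0 := by simp [HasExponents]

theorem right (a b : Q) : HasExponents a b b 0 1 := by simp [HasExponents]

theorem mul (hx : HasExponents a b x i j) (hy : HasExponents a b y i' j') :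
    HasExponents a b (x * y) (i + i') (j + j') := by
  rw [HasExponents] at *
  rw [map_mul, hx, hy, zpow_add, zpow_add, mul_mul_mul_comm]

theorem zpow (hx : HasExponents a b x i j) (c : ℤ) :
    HasExponents a b (x ^ c) (i * c) (j * c) := by
  rw [HasExponents] at *
  rw [map_zpow, hx, mul_zpow, zpow_mul, zpow_mul]

theorem conj (hx : HasExponents a b x i j) (g : Q) : HasExponents a b (g * x * g⁻¹) i j := by
  rw [HasExponents] at *
  rw [map_mul, map_mul, map_inv, mul_comm, inv_mul_cancel_left, hx]

end HasExponents

theorem eq_one_of_zpow_eq_one {p : ℕ} (hp : p.Prime) (hQ : IsPGroup p Q) {x : Q} {c : ℤ}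
    (hc : ¬ (p : ℤ) ∣ c) (hx : x ^ c = 1) : x = 1 := by
  obtain ⟨l, hl⟩ := hQ x
  have h : IsCoprime ((p : ℤ) ^ l) c :=
    ((Nat.prime_iff_prime_int.1 hp).coprime_iff_not_dvd.2 hc).pow_left
  obtain ⟨s, t, hst⟩ := h
  rw [← zpow_one x, ← hst, zpow_add, mul_comm, zpow_mul, mul_comm, zpow_mul, hx, ← Nat.cast_pow,
    zpow_natCast, hl, one_zpow, one_zpow, one_mul]

/-- A special case of Burnside's basis theorem. -/
theorem closure_pair_eq_top [Finite Q] {p : ℕ} (hp : p.Prime) (hQ : IsPGroup p Q) {a b x y : Q}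
    (hab : Subgroup.closure {a, b} = (⊤ : Subgroup Q)) {i j i' j' : ℤ}
    (hx : HasExponents a b x i j) (hy : HasExponents a b y i' j')
    (hdet : ¬ (p : ℤ) ∣ i * j' - j * i') : Subgroup.closure {x, y} = (⊤ : Subgroup Q) := by
  have : Fact p.Prime := ⟨hp⟩
  obtain h | ⟨M, hM, hle⟩ := eq_top_or_exists_le_coatom (Subgroup.closure {x, y})
  · exact h
  exfalso
  have : Group.IsNilpotent Q := hQ.isNilpotent
  have hN : M.Normal := Subgroup.NormalizerCondition.normal_of_coatom M
    Group.normalizerCondition_of_isNilpotent hM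
  -- The centre of the quotient by `M` is nontrivial, hence by maximality it is the whole quotient.
  have hcomm : commutator Q ≤ M := by
    have hQM : IsPGroup p (Q ⧸ M) := hQ.to_quotient M
    have : Nontrivial (Q ⧸ M) := QuotientGroup.nontrivial_iff.2 hM.1
    have hlt : M < (Subgroup.center (Q ⧸ M)).comap (QuotientGroup.mk' M) := by
      refine lt_of_le_of_ne (fun g hg => ?_) fun heq => ?_
      · rw [Subgroup.mem_comap, QuotientGroup.mk'_apply, (QuotientGroup.eq_one_iff g).2 hg]
        exact one_mem _
      · have : Nontrivial (Subgroup.center (Q ⧸ M)) := hQM.center_nontrivial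
        obtain ⟨⟨z, hz⟩, hz1⟩ := exists_ne (1 : Subgroup.center (Q ⧸ M))
        obtain ⟨g, rfl⟩ := QuotientGroup.mk_surjective z
        refine hz1 (Subtype.ext ((QuotientGroup.eq_one_iff g).2 ?_))
        rw [heq]
        exact hz
    have htop := hM.2 _ hlt
    rw [commutator_def, Subgroup.commutator_le]
    intro g _ h _
    rw [← QuotientGroup.eq_one_iff]
    have hg : (g : Q ⧸ M) ∈ Subgroup.center (Q ⧸ M) := by
      have : g ∈ (Subgroup.center (Q ⧸ M)).comap (QuotientGroup.mk' M) := htop ▸ Subgroup.mem_top g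
      exact this
    have := Subgroup.mem_center_iff.1 hg (h : Q ⧸ M)
    change (g * h * (g : Q ⧸ M)⁻¹ * (h : Q ⧸ M)⁻¹ : Q ⧸ M) = 1
    rw [← this]
    group
  have hmem : ∀ z ∈ M, ∀ i j : ℤ, HasExponents a b z i j →
      (a : Q ⧸ M) ^ i * (b : Q ⧸ M) ^ j = 1 := by
    intro z hz i j h
    have h1 : Abelianization.of (z⁻¹ * (a ^ i * b ^ j)) = 1 := by
      rw [map_mul, map_inv, h]
      simp
    rw [← MonoidHom.mem_ker, Abelianization.ker_of] at h1
    have h2 : a ^ i * b ^ j ∈ M := by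
      simpa using M.mul_mem hz (hcomm h1)
    exact (QuotientGroup.eq_one_iff _).2 h2
  have h1 := hmem x (hle (Subgroup.subset_closure (by simp))) i j hx
  have h2 := hmem y (hle (Subgroup.subset_closure (by simp))) i' j' hy
  have hAB : Commute (a : Q ⧸ M) (b : Q ⧸ M) := by
    have : a⁻¹ * b⁻¹ * a * b ∈ M := by
      have := hcomm (Subgroup.commutator_mem_commutator (Subgroup.mem_top a⁻¹)
        (Subgroup.mem_top b⁻¹))
      simpa [commutatorElement_def] using this
    have : ((a : Q ⧸ M)⁻¹ * (b : Q ⧸ M)⁻¹ * a * b : Q ⧸ M) = 1 := (QuotientGroup.eq_one_iff _).2 this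
    have h3 : (b * a : Q ⧸ M) * ((a : Q ⧸ M)⁻¹ * (b : Q ⧸ M)⁻¹ * a * b) = b * a := by rw [this, mul_one]
    rw [Commute, SemiconjBy, ← h3]
    group
  have hcr : ∀ r s : ℤ, Commute ((a : Q ⧸ M) ^ r) ((b : Q ⧸ M) ^ s) := fun r s =>
    (hAB.zpow_left r).zpow_right s
  have hA : (a : Q ⧸ M) ^ (i * j' - j * i') = 1 := by
    have e1 : ((a : Q ⧸ M) ^ i * (b : Q ⧸ M) ^ j) ^ j' *
      ((a : Q ⧸ M) ^ i' * (b : Q ⧸ M) ^ j') ^ (-j) = 1 := by rw [h1, h2, one_zpow, one_zpow, one_mul]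
    rw [(hcr _ _).mul_zpow, (hcr _ _).mul_zpow, ← zpow_mul, ← zpow_mul, ← zpow_mul, ← zpow_mul,
      mul_assoc, ← mul_assoc ((b : Q ⧸ M) ^ (j * j')), ← (hcr _ _).eq, mul_assoc, ← zpow_add,
      ← mul_assoc, ← zpow_add] at e1
    rw [← e1, show j * j' + j' * -j = 0 by ring, zpow_zero, mul_one]
    congr 1
    ring
  have hB : (b : Q ⧸ M) ^ (i * j' - j * i') = 1 := by
    have e1 : ((a : Q ⧸ M) ^ i * (b : Q ⧸ M) ^ j) ^ (-i') *
      ((a : Q ⧸ M) ^ i' * (b : Q ⧸ M) ^ j') ^ i = 1 := by rw [h1, h2, one_zpow, one_zpow, one_mul]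
    rw [(hcr _ _).mul_zpow, (hcr _ _).mul_zpow, ← zpow_mul, ← zpow_mul, ← zpow_mul, ← zpow_mul,
      mul_assoc, ← mul_assoc ((b : Q ⧸ M) ^ (j * -i')), ← (hcr _ _).eq, mul_assoc, ← zpow_add,
      ← mul_assoc, ← zpow_add] at e1
    rw [← e1, show i * -i' + i' * i = 0 by ring, zpow_zero, one_mul]
    congr 1
    ring
  refine hM.1 (top_unique (hab.symm.le.trans ((Subgroup.closure_le M).2 ?_)))
  rintro z (rfl | rfl)
  · exact (QuotientGroup.eq_one_iff _).1 (eq_one_of_zpow_eq_one hp (hQ.to_quotient M) hdet hA)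
  · exact (QuotientGroup.eq_one_iff _).1 (eq_one_of_zpow_eq_one hp (hQ.to_quotient M) hdet hB)

/-- Every conjugate of `⟨x⟩` meets every conjugate of `⟨y⟩` trivially. -/
def ConjTrivialInter (x y : Q) : Prop :=
  ∀ (f : Q) (c d : ℤ), SemiconjBy f (x ^ c) (y ^ d) → x ^ c = 1

theorem ConjTrivialInter.symm {x y : Q} (h : ConjTrivialInter x y) : ConjTrivialInter y x := by
  intro f c d hf
  have h1 := h f⁻¹ d c hf.inv_symm_left
  rw [h1, SemiconjBy, one_mul] at hf
  exact mul_eq_left.1 hf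

/-- No nontrivial power of `x` is central. -/
def HasNoCentralPower (x : Q) : Prop :=
  ∀ c : ℤ, x ^ c ∈ Subgroup.center Q → x ^ c = 1

/-- An element common to `⟨x⟩` and a conjugate of `⟨y⟩` commutes with `x` and that conjugate of
`y`, which generate the group. -/
theorem ConjTrivialInter.of_hasNoCentralPower [Finite Q] {p : ℕ} (hp : p.Prime)
    (hQ : IsPGroup p Q) {a b x y : Q} (hab : Subgroup.closure {a, b} = (⊤ : Subgroup Q))
    {i j i' j' : ℤ} (hx : HasExponents a b x i j) (hy : HasExponents a b y i' j')
    (hdet : ¬ (p : ℤ) ∣ i * j' - j * i') (h : HasNoCentralPower x) : ConjTrivialInter x y := by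
  intro f c d hf
  refine h c ?_
  have htop := closure_pair_eq_top hp hQ hab hx (hy.conj f⁻¹) hdet
  rw [← Subgroup.centralizer_univ, ← Subgroup.coe_top, ← htop, Subgroup.centralizer_closure,
    Subgroup.mem_centralizer_iff]
  have hxc : x ^ c = (f⁻¹ * y * f⁻¹⁻¹) ^ d := by
    rw [conj_zpow, inv_inv, mul_assoc, ← hf.eq, inv_mul_cancel_left]
  rintro z (rfl | rfl)
  · exact (Commute.refl _).zpow_right c
  · rw [hxc]
    exact (Commute.refl _).zpow_right d

theorem isBeauvilleStructure_of_conjTrivialInter {x₁ y₁ x₂ y₂ : Q}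
    (h₁ : Subgroup.closure {x₁, y₁} = (⊤ : Subgroup Q))
    (h₂ : Subgroup.closure {x₂, y₂} = (⊤ : Subgroup Q))
    (h : ∀ u ∈ ({x₁, y₁, x₁ * y₁} : Set Q), ∀ w ∈ ({x₂, y₂, x₂ * y₂} : Set Q),
      ConjTrivialInter u w) : IsBeauvilleStructure x₁ y₁ x₂ y₂ := by
  refine ⟨h₁, h₂, Set.eq_singleton_iff_unique_mem.2 ⟨⟨⟨1, Or.inl ?_⟩, ⟨1, Or.inl ?_⟩⟩, ?_⟩⟩
  · simp
  · simp
  · have key : ∀ {x y t : Q}, t ∈ beauvilleSigma x y →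
        ∃ u ∈ ({x, y, x * y} : Set Q), ∃ (g : Q) (c : ℤ), u ^ c = g⁻¹ * t * g := by
      rintro x y t ⟨g, ⟨c, hc⟩ | ⟨c, hc⟩ | ⟨c, hc⟩⟩
      exacts [⟨x, by simp, g, c, hc⟩, ⟨y, by simp, g, c, hc⟩, ⟨x * y, by simp, g, c, hc⟩]
    rintro t ⟨ht₁, ht₂⟩
    obtain ⟨u, hu, g, c, hc⟩ := key ht₁
    obtain ⟨w, hw, g', d, hd⟩ := key ht₂
    have h1 := h u hu w hw (g'⁻¹ * g) c d (by rw [SemiconjBy, hc, hd]; group)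
    rw [h1] at hc
    have : t = g * (g⁻¹ * t * g) * g⁻¹ := by group
    rw [this, ← hc]
    group

end Groups

/-! ### Congruence quotients -/

section Quotients

variable {q : ℕ → ℕ} {n k : ℕ} {e : ℕ → ℤ} {Q : Type*} [Group Q]

/-- `IsCongruenceQuotient k e φ a b`: the group `Q` is generated by `a` and `b` and acts faithfully
through `φ` on level `n`, the elements `a` and `b` acting as the rooted and as the directed
automorphism. -/
structure IsCongruenceQuotient (k : ℕ) (e : ℕ → ℤ) (φ : Q →* Equiv.Perm (Level q n)) (a b : Q) :
    Prop where
  injective : Function.Injective φ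
  map_left : φ a = rootedLevel q n
  map_right : φ b = directedLevel k e q n
  closure_eq_top : Subgroup.closure {a, b} = (⊤ : Subgroup Q)

namespace IsCongruenceQuotient

variable {a b : Q}

section Labels

variable {φ : Q →* Equiv.Perm (Level q (n + 1))}

theorem exists_hasLabelSums (h : IsCongruenceQuotient k e φ a b) (hk : 0 < k)
    (hkq : ∀ i, k ≤ q i) (x : Q) : ∃ L, HasLabelSums q (n + 1) (φ x) L := by
  have hq : ∀ i, q i ≠ 0 := fun i => (hk.trans_le (hkq i)).ne'
  have hx : x ∈ Subgroup.closure {a, b} := h.closure_eq_top ▸ Subgroup.mem_top x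
  induction hx using Subgroup.closure_induction with
  | mem z hz =>
    rcases hz with rfl | rfl
    · obtain ⟨L, hL, -⟩ := exists_hasLabelSums_rootedLevel q n
      exact ⟨L, h.map_left ▸ hL⟩
    · obtain ⟨L, hL, -⟩ := exists_hasLabelSums_directedLevel (e := e) hk hkq n
      exact ⟨L, h.map_right ▸ hL⟩
  | one => exact ⟨0, by rw [map_one]; exact .one _ _⟩
  | mul y z _ _ hy hz =>
    obtain ⟨L, hL⟩ := hy
    obtain ⟨L', hL'⟩ := hz
    exact ⟨L + L', by rw [map_mul]; exact hL.mul hq hL'⟩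
  | inv y _ hy =>
    obtain ⟨L, hL⟩ := hy
    exact ⟨-L, by rw [map_inv]; exact hL.inv hq⟩

theorem finite (h : IsCongruenceQuotient k e φ a b) (hq : ∀ i, q i ≠ 0) : Finite Q := by
  have := finite_level q (n + 1) hq
  exact Finite.of_injective φ h.injective

theorem isPGroup (h : IsCongruenceQuotient k e φ a b) (hk : 0 < k) (hkq : ∀ i, k ≤ q i)
    {p : ℕ} {m : ℕ → ℕ} (hm : ∀ i, q i = p ^ m i) : IsPGroup p Q := by
  intro x
  obtain ⟨L, hL⟩ := h.exists_hasLabelSums hk hkq x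
  refine ⟨∑ i ∈ Finset.range (n + 1), m i, h.injective ?_⟩
  rw [map_pow, map_one, ← Finset.prod_pow_eq_pow_sum]
  simp only [← hm]
  exact hL.pow_prod_eq_one fun i => (hk.trans_le (hkq i)).ne'

theorem exists_hasLabelSums_zpow_mul_zpow (h : IsCongruenceQuotient k e φ a b) (hk : 0 < k)
    (hkq : ∀ i, k ≤ q i) (i j : ℤ) : ∃ L, HasLabelSums q (n + 1) (φ (a ^ i * b ^ j)) L ∧ L 0 = i ∧
      ∀ l < n, L (l + 1) = ((j * ∑ i ∈ Finset.Icc 1 (k - 1), e i : ℤ) : ZMod (q (l + 1))) := by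
  have hq : ∀ i, q i ≠ 0 := fun i => (hk.trans_le (hkq i)).ne'
  obtain ⟨A, hA, hA0, hA1⟩ := exists_hasLabelSums_rootedLevel q n
  obtain ⟨B, hB, hB0, hB1⟩ := exists_hasLabelSums_directedLevel (e := e) hk hkq n
  refine ⟨i • A + j • B, ?_, ?_, fun l hl => ?_⟩
  · rw [map_mul, map_zpow, map_zpow, h.map_left, h.map_right]
    exact (hA.zpow hq i).mul hq (hB.zpow hq j)
  · simp [hA0, hB0]
  · rw [Pi.add_apply, Pi.smul_apply, Pi.smul_apply, hA1, hB1 l hl, smul_zero, zero_add,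
      zsmul_eq_mul, Int.cast_mul]

end Labels

/-! ### Defining vectors with sum zero -/

section SumZero

variable {φ : Q →* Equiv.Perm (Level q (n + 3))}

theorem hasNoCentralPower_right (h : IsCongruenceQuotient k e φ a b) (hA : IsAdmissible q k e) :
    HasNoCentralPower b := by
  intro c hc
  apply h.injective
  rw [map_one, map_zpow, h.map_right]
  refine directedLevel_zpow_eq_one_of_commute (hA.one_lt 0) ?_
  rw [← h.map_left, ← h.map_right, ← map_zpow]
  exact Commute.map (Subgroup.mem_center_iff.1 hc a) φ

theorem hasNoCentralPower_mul_zpow (h : IsCongruenceQuotient k e φ a b) (hA : IsAdmissible q k e)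
    (hsum : ∑ i ∈ Finset.Icc 1 (k - 1), e i = 0) (j : ℤ) : HasNoCentralPower (a * b ^ j) := by
  intro c hc
  obtain ⟨L, hL⟩ := h.exists_hasLabelSums hA.pos hA.le ((a * b ^ j) ^ c)
  have hφ : φ ((a * b ^ j) ^ c) =
      (rootedLevel q (n + 3) * directedLevel k e q (n + 3) ^ j) ^ c := by
    rw [map_zpow, map_mul, map_zpow, h.map_left, h.map_right]
  apply h.injective
  rw [map_one, hφ]
  refine rooted_mul_directed_zpow_eq_one_of_commute hA hsum (hφ ▸ hL) ?_ ?_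
  · rw [← hφ, ← h.map_left]
    exact (Commute.map (Subgroup.mem_center_iff.1 hc a) φ).symm
  · rw [← hφ, ← h.map_right]
    exact (Commute.map (Subgroup.mem_center_iff.1 hc b) φ).symm

theorem conjTrivialInter_left (h : IsCongruenceQuotient k e φ a b) (hA : IsAdmissible q k e)
    (hsum : ∑ i ∈ Finset.Icc 1 (k - 1), e i = 0) {j : ℤ} (hj : (q 0 : ℤ) * j ∣ q (n + 2))
    (hj0 : j ≠ 0) : ConjTrivialInter a (a * b ^ j) := by
  intro f c d hf
  obtain ⟨L, hL⟩ := h.exists_hasLabelSums hA.pos hA.le f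
  apply h.injective
  rw [map_one, map_zpow, h.map_left]
  refine rootedLevel_zpow_eq_one_of_semiconjBy hA hsum hj hj0 hL (d := d) ?_
  simpa only [map_zpow, map_mul, h.map_left, h.map_right] using hf.map φ

theorem conjTrivialInter_right (h : IsCongruenceQuotient k e φ a b) (hA : IsAdmissible q k e)
    {t : ℤ} (ht : ¬ (q 0 : ℤ) ∣ t) (j : ℤ) : ConjTrivialInter b (a ^ t * b ^ j) := by
  intro f c d hf
  have hq := hA.ne_zero
  obtain ⟨L, hL⟩ := h.exists_hasLabelSums hA.pos hA.le f
  obtain ⟨M, hM, hM0, -⟩ := h.exists_hasLabelSums_zpow_mul_zpow hA.pos hA.le t j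
  have hg : HasLabelSums q (n + 3) (φ (f⁻¹ * (a ^ t * b ^ j) * f)) (-L + M + L) := by
    rw [map_mul, map_mul _ f⁻¹, map_inv]
    exact ((hL.inv hq).mul hq hM).mul hq hL
  apply h.injective
  rw [map_one, map_zpow, h.map_right]
  refine directedLevel_zpow_eq_one_of_commute_of_label_ne_zero hA hg ?_ ?_
  · have : (-L + M + L) 0 = (t : ZMod (q 0)) := by simp [hM0]
    rw [this]
    exact fun h0 => ht ((ZMod.intCast_zmod_eq_zero_iff_dvd _ _).1 h0)
  · rw [← h.map_right, ← map_zpow]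
    refine Commute.map ?_ φ
    have hbc : b ^ c = (f⁻¹ * (a ^ t * b ^ j) * f⁻¹⁻¹) ^ d := by
      rw [conj_zpow, inv_inv, mul_assoc, ← hf.eq, inv_mul_cancel_left]
    rw [hbc, inv_inv]
    exact (Commute.refl _).zpow_right d

theorem conjTrivialInter_right_mul_conj {φ : Q →* Equiv.Perm (Level q (n + 3))}
    (h : IsCongruenceQuotient 3 e φ a b) (hA : IsAdmissible q 3 e)
    (hq0 : q 0 = 3) (hsum : ∑ i ∈ Finset.Icc 1 (3 - 1), e i = 0)
    (hcop : ∀ i, IsCoprime (q i : ℤ) (e 1)) : ConjTrivialInter b (b * (a * b * a⁻¹)) := by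
  refine ConjTrivialInter.symm fun f d c hf => ?_
  obtain ⟨L, hL⟩ := h.exists_hasLabelSums hA.pos hA.le f
  have hb : b ^ c = 1 := by
    apply h.injective
    rw [map_one, map_zpow, h.map_right]
    refine directedLevel_zpow_eq_one_of_semiconjBy_mul_conj hA hq0 hsum hcop hL (d := d) ?_
    simpa only [map_zpow, map_mul, map_inv, h.map_left, h.map_right] using hf.map φ
  rw [hb, SemiconjBy, one_mul] at hf
  exact mul_eq_left.1 hf

theorem not_isCyclic (h : IsCongruenceQuotient k e φ a b) (hA : IsAdmissible q k e) :
    ¬ IsCyclic Q := by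
  intro hQ
  have hb : b = 1 := by
    have := h.hasNoCentralPower_right hA 1
    rw [zpow_one] at this
    exact this (Subgroup.mem_center_iff.2 fun g => hQ.isMulCommutative.is_comm.comm g b)
  have := h.map_right
  rw [hb, map_one] at this
  exact directedLevel_ne_one hA this.symm

theorem isBeauvilleStructure_of_five_le (h : IsCongruenceQuotient k e φ a b)
    (hA : IsAdmissible q k e) (hsum : ∑ i ∈ Finset.Icc 1 (k - 1), e i = 0) {p : ℕ} (hp : p.Prime)
    (hp5 : 5 ≤ p) {m : ℕ → ℕ} (hm : ∀ i, q i = p ^ m i) :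
    IsBeauvilleStructure (a ^ (-2 : ℤ)) (a * b) (a * b ^ 2) b := by
  have hfin := h.finite hA.ne_zero
  have hQ := h.isPGroup hA.pos hA.le hm
  have hdet : ∀ d : ℤ, d ∣ 12 → ¬ (p : ℤ) ∣ d := by
    intro d hd hpd
    have h12 : p ∣ 2 * 2 * 3 := by exact_mod_cast hpd.trans hd
    rw [hp.dvd_mul, hp.dvd_mul] at h12
    rcases h12 with (h12 | h12) | h12 <;> have := Nat.le_of_dvd (by decide) h12 <;> omega
  have ha := HasExponents.left a b
  have hb := HasExponents.right a b
  have hx₁ := ha.zpow (-2)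
  have hy₁ := ha.mul hb
  have hb2 : HasExponents a b (b ^ 2) 0 2 := by simpa using hb.zpow 2
  have hx₂ := ha.mul hb2
  have hc : ∀ j : ℕ, HasNoCentralPower (a * b ^ j) := fun j => by
    simpa using h.hasNoCentralPower_mul_zpow hA hsum j
  have key : ∀ {w : Q} {i j : ℤ}, HasExponents a b w i j → HasNoCentralPower w →
      (2 * j ∣ 12) → (i - j ∣ 12) → (i + j ∣ 12) →
      ∀ u ∈ ({a ^ (-2 : ℤ), a * b, a ^ (-2 : ℤ) * (a * b)} : Set Q), ConjTrivialInter u w := by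
    intro w i j hw hwc d₁ d₂ d₃ u hu
    refine ConjTrivialInter.symm ?_
    rcases hu with rfl | rfl | rfl
    · refine .of_hasNoCentralPower hp hQ h.closure_eq_top hw hx₁ (hdet _ ?_) hwc
      ring_nf
      rwa [mul_comm]
    · refine .of_hasNoCentralPower hp hQ h.closure_eq_top hw hy₁ (hdet _ ?_) hwc
      ring_nf
      exact d₂
    · refine .of_hasNoCentralPower hp hQ h.closure_eq_top hw (hx₁.mul hy₁) (hdet _ ?_) hwc
      ring_nf
      exact d₃
  refine isBeauvilleStructure_of_conjTrivialInter
    (closure_pair_eq_top hp hQ h.closure_eq_top hx₁ hy₁ (hdet _ (by norm_num)))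
    (closure_pair_eq_top hp hQ h.closure_eq_top hx₂ hb (hdet _ (by norm_num)))
    fun u hu w hw => ?_
  rcases hw with rfl | rfl | rfl
  · exact key hx₂ (hc 2) (by norm_num) (by norm_num) (by norm_num) u hu
  · exact key hb (h.hasNoCentralPower_right hA) (by norm_num) (by norm_num) (by norm_num) u hu
  · refine key (hx₂.mul hb) ?_ (by norm_num) (by norm_num) (by norm_num) u hu
    rw [mul_assoc, ← pow_succ]
    exact hc 3

/-- For `p = 3` the triples `x, y, x * y` of any two generating pairs have at least two directions
modulo the Frattini subgroup in common. Here these are the directions of `a` and of `b`; the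
elements `a * b ^ 3` and `y` are chosen to have powers avoiding the conjugates of `⟨a⟩` and of `⟨b⟩`. -/
theorem isBeauvilleStructure_three (h : IsCongruenceQuotient k e φ a b)
    (hA : IsAdmissible q k e) (hsum : ∑ i ∈ Finset.Icc 1 (k - 1), e i = 0)
    {m : ℕ → ℕ} (hm : ∀ i, q i = 3 ^ m i) (hlt : m 0 < m (n + 2)) {y : Q} {i j : ℤ}
    (hy : HasExponents a b y i j) (hby : ConjTrivialInter b y)
    (hi : (3 : ℤ) ∣ i) (hj : (3 : ℤ) ∣ j + 1) :
    IsBeauvilleStructure a b (a * b ^ (3 : ℤ)) y := by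
  have hfin := h.finite hA.ne_zero
  have hQ := h.isPGroup hA.pos hA.le hm
  have hp : Nat.Prime 3 := Nat.prime_three
  have ha := HasExponents.left a b
  have hb := HasExponents.right a b
  have hx := ha.mul (hb.zpow 3)
  have hca : HasNoCentralPower a := by simpa using h.hasNoCentralPower_mul_zpow hA hsum 0
  have hcb := h.hasNoCentralPower_right hA
  have hcab : HasNoCentralPower (a * b) := by simpa using h.hasNoCentralPower_mul_zpow hA hsum 1
  have hax : ConjTrivialInter a (a * b ^ (3 : ℤ)) := by
    refine h.conjTrivialInter_left hA hsum ?_ (by decide)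
    rw [hm, hm]
    push_cast
    rw [← pow_succ]
    exact pow_dvd_pow 3 hlt
  have key : ∀ {u w : Q} {r s r' s' : ℤ}, HasExponents a b u r s → HasNoCentralPower u →
      HasExponents a b w r' s' → ¬ (3 : ℤ) ∣ r * s' - s * r' → ConjTrivialInter u w :=
    fun hu huc hw hd => .of_hasNoCentralPower hp hQ h.closure_eq_top hu hw hd huc
  refine isBeauvilleStructure_of_conjTrivialInter h.closure_eq_top
    (closure_pair_eq_top hp hQ h.closure_eq_top hx hy (by push_cast; omega))
    fun u hu w hw => ?_
  rcases hu with rfl | rfl | rfl <;> rcases hw with rfl | rfl | rfl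
  · exact hax
  · exact key ha hca hy (by omega)
  · exact key ha hca (hx.mul hy) (by omega)
  · exact key hb hcb hx (by omega)
  · exact hby
  · exact key hb hcb (hx.mul hy) (by omega)
  · exact key (ha.mul hb) hcab hx (by omega)
  · exact key (ha.mul hb) hcab hy (by omega)
  · exact key (ha.mul hb) hcab (hx.mul hy) (by omega)

end SumZero

end IsCongruenceQuotient

end Quotients

/-! ### Defining vectors with sum prime to `p` -/

theorem isUnit_intCast_zmod_of_not_dvd {p N l : ℕ} (hp : p.Prime) (hN : N = p ^ l) {c : ℤ}
    (hc : ¬ (p : ℤ) ∣ c) : IsUnit (c : ZMod N) := by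
  rw [ZMod.coe_int_isUnit_iff_isCoprime, hN, Nat.cast_pow]
  exact ((Nat.prime_iff_prime_int.1 hp).coprime_iff_not_dvd.2 hc).pow_left

theorem dvd_sub_of_intCast_zmod_eq {p N l : ℕ} (hN : N = p ^ l) (hl : 0 < l) {c d : ℤ}
    (h : (c : ZMod N) = d) : (p : ℤ) ∣ d - c := by
  rw [ZMod.intCast_eq_intCast_iff_dvd_sub, hN] at h
  refine dvd_trans ?_ h
  exact_mod_cast dvd_pow_self p hl.ne'

namespace IsCongruenceQuotient

variable {q : ℕ → ℕ} {n k : ℕ} {e : ℕ → ℤ} {Q : Type*} [Group Q]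
  {φ : Q →* Equiv.Perm (Level q (n + 1))} {a b : Q}

/-- If `x` and `y` generate, one of `x`, `y`, `x * y` has all its label sums prime to `p`. -/
theorem exists_isUnit_labelSums (h : IsCongruenceQuotient k e φ a b) (hk : 0 < k)
    (hkq : ∀ i, k ≤ q i) {p : ℕ} (hp : p.Prime) {m : ℕ → ℕ} (hm : ∀ i, q i = p ^ m i)
    (hm0 : ∀ i, 0 < m i) (hs : ¬ (p : ℤ) ∣ ∑ i ∈ Finset.Icc 1 (k - 1), e i) {x y : Q}
    (hxy : Subgroup.closure {x, y} = (⊤ : Subgroup Q)) :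
    ∃ w ∈ ({x, y, x * y} : Set Q), ∃ L, HasLabelSums q (n + 1) (φ w) L ∧ ∀ l ≤ n, IsUnit (L l) := by
  have hq : ∀ i, q i ≠ 0 := fun i => (hk.trans_le (hkq i)).ne'
  set s := ∑ i ∈ Finset.Icc 1 (k - 1), e i with hs_def
  let P (z : Q) (i j : ℤ) : Prop := ∃ L, HasLabelSums q (n + 1) (φ z) L ∧ L 0 = i ∧
    ∀ l < n, L (l + 1) = ((j * s : ℤ) : ZMod (q (l + 1)))
  have P_one : P 1 0 0 := ⟨0, by rw [map_one]; exact .one _ _, by simp, fun l _ => by simp⟩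
  have P_mul : ∀ {z z' i j i' j'}, P z i j → P z' i' j' → P (z * z') (i + i') (j + j') := by
    rintro z z' i j i' j' ⟨L, hL, hL0, hL1⟩ ⟨L', hL', hL0', hL1'⟩
    refine ⟨L + L', by rw [map_mul]; exact hL.mul hq hL', ?_, fun l hl => ?_⟩
    · rw [Pi.add_apply, hL0, hL0', Int.cast_add]
    · rw [Pi.add_apply, hL1 l hl, hL1' l hl, add_mul, Int.cast_add]
  have P_inv : ∀ {z i j}, P z i j → P z⁻¹ (-i) (-j) := by
    rintro z i j ⟨L, hL, hL0, hL1⟩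
    refine ⟨-L, by rw [map_inv]; exact hL.inv hq, ?_, fun l hl => ?_⟩
    · rw [Pi.neg_apply, hL0, Int.cast_neg]
    · rw [Pi.neg_apply, hL1 l hl, neg_mul, Int.cast_neg]
  have Pa : P a 1 0 := by
    obtain ⟨L, hL, hL0, hL1⟩ := h.exists_hasLabelSums_zpow_mul_zpow hk hkq 1 0
    exact ⟨L, by simpa using hL, hL0, hL1⟩
  have Pb : P b 0 1 := by
    obtain ⟨L, hL, hL0, hL1⟩ := h.exists_hasLabelSums_zpow_mul_zpow hk hkq 0 1
    exact ⟨L, by simpa using hL, hL0, hL1⟩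
  have P_exists : ∀ z, ∃ i j, P z i j := by
    intro z
    have hz : z ∈ Subgroup.closure {a, b} := h.closure_eq_top ▸ Subgroup.mem_top z
    induction hz using Subgroup.closure_induction with
    | mem z hz =>
      rcases hz with rfl | rfl
      exacts [⟨1, 0, Pa⟩, ⟨0, 1, Pb⟩]
    | one => exact ⟨0, 0, P_one⟩
    | mul z z' _ _ hz hz' =>
      obtain ⟨i, j, hz⟩ := hz
      obtain ⟨i', j', hz'⟩ := hz'
      exact ⟨_, _, P_mul hz hz'⟩
    | inv z _ hz =>
      obtain ⟨i, j, hz⟩ := hz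
      exact ⟨_, _, P_inv hz⟩
  obtain ⟨i, j, hx⟩ := P_exists x
  obtain ⟨i', j', hy⟩ := P_exists y
  have P_span : ∀ z, ∃ c d : ℤ, P z (c * i + d * i') (c * j + d * j') := by
    intro z
    have hz : z ∈ Subgroup.closure {x, y} := hxy ▸ Subgroup.mem_top z
    induction hz using Subgroup.closure_induction with
    | mem z hz =>
      rcases hz with rfl | rfl
      exacts [⟨1, 0, by simpa using hx⟩, ⟨0, 1, by simpa using hy⟩]
    | one => exact ⟨0, 0, by simpa using P_one⟩
    | mul z z' _ _ hz hz' =>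
      obtain ⟨c, d, hz⟩ := hz
      obtain ⟨c', d', hz'⟩ := hz'
      refine ⟨c + c', d + d', ?_⟩
      convert P_mul hz hz' using 1 <;> ring
    | inv z _ hz =>
      obtain ⟨c, d, hz⟩ := hz
      refine ⟨-c, -d, ?_⟩
      convert P_inv hz using 1 <;> ring
  have P_unique : ∀ {z i j i' j'}, P z i j → P z i' j' →
      (p : ℤ) ∣ i' - i ∧ (0 < n → (p : ℤ) ∣ j' - j) := by
    rintro z i j i' j' ⟨L, hL, hL0, hL1⟩ ⟨L', hL', hL0', hL1'⟩
    obtain rfl := hL.unique hL'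
    refine ⟨dvd_sub_of_intCast_zmod_eq (hm 0) (hm0 0) (hL0.symm.trans hL0'), fun hn => ?_⟩
    have := dvd_sub_of_intCast_zmod_eq (hm _) (hm0 _) ((hL1 0 hn).symm.trans (hL1' 0 hn))
    rw [← sub_mul] at this
    exact ((Nat.prime_iff_prime_int.1 hp).dvd_or_dvd this).resolve_right hs
  -- It remains to find an element whose two exponents are prime to `p`.
  suffices hgood : ∃ w ∈ ({x, y, x * y} : Set Q), ∃ i j, P w i j ∧ ¬ (p : ℤ) ∣ i ∧
      (0 < n → ¬ (p : ℤ) ∣ j) by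
    obtain ⟨w, hw, i, j, ⟨L, hL, hL0, hL1⟩, hi, hj⟩ := hgood
    refine ⟨w, hw, L, hL, fun l hl => ?_⟩
    cases l with
    | zero =>
      rw [hL0]
      exact isUnit_intCast_zmod_of_not_dvd hp (hm 0) hi
    | succ l =>
      rw [hL1 l hl]
      exact isUnit_intCast_zmod_of_not_dvd hp (hm _) fun hd =>
        ((Nat.prime_iff_prime_int.1 hp).dvd_or_dvd hd).elim (hj (by omega)) hs
  have : Fact p.Prime := ⟨hp⟩
  obtain ⟨c, d, ha⟩ := P_span a
  obtain ⟨c', d', hb⟩ := P_span b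
  obtain ⟨ha0, ha1⟩ := P_unique ha Pa
  obtain ⟨hb0, hb1⟩ := P_unique hb Pb
  by_contra hbad
  have hbad' : ∀ w ∈ ({x, y, x * y} : Set Q), ∀ i j, P w i j → ¬ (p : ℤ) ∣ i →
      0 < n ∧ (p : ℤ) ∣ j := by
    intro w hw i j hP hi
    by_contra hcon
    exact hbad ⟨w, hw, i, j, hP, hi, fun hn hj => hcon ⟨hn, hj⟩⟩
  have b1 := hbad' x (by simp) _ _ hx
  have b2 := hbad' y (by simp) _ _ hy
  have b3 := hbad' (x * y) (by simp) _ _ (P_mul hx hy)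
  have hn : 0 < n := by
    by_contra hn
    have d1 : (p : ℤ) ∣ i := by
      by_contra hd
      exact hn (b1 hd).1
    have d2 : (p : ℤ) ∣ i' := by
      by_contra hd
      exact hn (b2 hd).1
    have := (dvd_add ((dvd_add (d1.mul_left c) (d2.mul_left d))) ha0)
    rw [add_sub_cancel] at this
    exact (Nat.prime_iff_prime_int.1 hp).not_dvd_one this
  replace ha1 := ha1 hn
  replace hb1 := hb1 hn
  have toZero : ∀ {i j : ℤ}, (¬ (p : ℤ) ∣ i → 0 < n ∧ (p : ℤ) ∣ j) →
      (i : ZMod p) * (j : ZMod p) = 0 := by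
    intro i j hij
    by_cases hi : (p : ℤ) ∣ i
    · rw [(ZMod.intCast_zmod_eq_zero_iff_dvd _ _).2 hi, zero_mul]
    · rw [(ZMod.intCast_zmod_eq_zero_iff_dvd _ _).2 (hij hi).2, mul_zero]
  have z1 := toZero b1
  have z2 := toZero b2
  have z3 := toZero b3
  rw [← ZMod.intCast_zmod_eq_zero_iff_dvd] at ha0 ha1 hb0 hb1
  push_cast at z3 ha0 ha1 hb0 hb1
  have hsum0 : (i * j' : ZMod p) + i' * j = 0 := by linear_combination z3 - z1 - z2
  have hsq : (i * j' : ZMod p) ^ 2 = 0 := by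
    linear_combination (i * j' : ZMod p) * hsum0 - (i' * j' : ZMod p) * z1
  have hz : (i * j' : ZMod p) = 0 := by simpa using hsq
  have : (1 : ZMod p) = 0 := by
    linear_combination ha0 + hb1 * (c * i + d * i') - ha1 * (c' * i + d' * i') +
      (c * d' - c' * d : ZMod p) * (2 * hz - hsum0)
  exact one_ne_zero this

/-- The powers of an element whose label sums are units reach the group of all rotations of the
last letter, which is central. -/
theorem exists_central_subgroup (h : IsCongruenceQuotient k e φ a b) (hk : 0 < k)
    (hkq : ∀ i, k ≤ q i) {p : ℕ} (hp : p.Prime) {m : ℕ → ℕ} (hm : ∀ i, q i = p ^ m i)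
    (hm0 : ∀ i, 0 < m i) (hs : ¬ (p : ℤ) ∣ ∑ i ∈ Finset.Icc 1 (k - 1), e i) :
    ∃ Z : Subgroup Q, Z ≤ Subgroup.center Q ∧ IsCyclic Z ∧ Z ≠ ⊥ ∧
      ∀ x y : Q, Subgroup.closure {x, y} = (⊤ : Subgroup Q) →
        (Z : Set Q) ⊆ beauvilleSigma x y := by
  have hq : ∀ i, q i ≠ 0 := fun i => (hk.trans_le (hkq i)).ne'
  obtain ⟨w₀, -, L₀, hL₀, hu₀⟩ := h.exists_isUnit_labelSums hk hkq hp hm hm0 hs h.closure_eq_top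
  have hz : φ (w₀ ^ ∏ i ∈ Finset.range n, q i) = lastRot q n (L₀ n) := by
    rw [map_pow]
    exact hL₀.pow_prod_eq_lastRot hq fun i hi => hu₀ i hi.le
  refine ⟨Subgroup.zpowers (w₀ ^ ∏ i ∈ Finset.range n, q i), ?_, inferInstance, ?_, ?_⟩
  · rw [Subgroup.zpowers_le, Subgroup.mem_center_iff]
    intro g
    obtain ⟨L, hL⟩ := h.exists_hasLabelSums hk hkq g
    apply h.injective
    rw [map_mul, map_mul, hz]
    exact hL.commute_lastRot _
  · rw [Ne, Subgroup.zpowers_eq_bot]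
    intro h1
    rw [h1, map_one, eq_comm, lastRot_eq_one] at hz
    have hu := hu₀ n le_rfl
    have : Fact (1 < q n) := ⟨hm n ▸ Nat.one_lt_pow (hm0 n).ne' hp.one_lt⟩
    rw [hz] at hu
    exact not_isUnit_zero hu
  · intro x y hxy
    obtain ⟨w, hw, L, hL, hu⟩ := h.exists_isUnit_labelSums hk hkq hp hm hm0 hs hxy
    have hmem : w₀ ^ ∏ i ∈ Finset.range n, q i ∈ Subgroup.zpowers w := by
      obtain ⟨v, hv⟩ := hu n le_rfl
      have : NeZero (q n) := ⟨hq n⟩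
      have hcast : (((L₀ n * ↑v⁻¹ : ZMod (q n)).val : ℕ) : ZMod (q n)) * L n = L₀ n := by
        rw [ZMod.natCast_zmod_val, ← hv, Units.inv_mul_cancel_right]
      have : w₀ ^ ∏ i ∈ Finset.range n, q i =
          (w ^ ∏ i ∈ Finset.range n, q i) ^ (L₀ n * ↑v⁻¹ : ZMod (q n)).val := by
        apply h.injective
        rw [hz, map_pow, map_pow, hL.pow_prod_eq_lastRot hq fun i hi => hu i hi.le,
          ← lastRot_nsmul, hcast]
      rw [this]
      exact Subgroup.pow_mem _ (Subgroup.pow_mem _ (Subgroup.mem_zpowers w) _) _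
    intro z hzZ
    have hzw : z ∈ Subgroup.zpowers w := (Subgroup.zpowers_le.2 hmem) hzZ
    refine ⟨1, ?_⟩
    rw [inv_one, one_mul, mul_one]
    rcases hw with rfl | rfl | rfl
    exacts [Or.inl hzw, Or.inr (Or.inl hzw), Or.inr (Or.inr hzw)]

end IsCongruenceQuotient

theorem not_isBeauvilleGroup_of_central_subgroup {Q : Type*} [Group Q] {Z : Subgroup Q}
    (hZ : Z ≠ ⊥) (h : ∀ x y : Q, Subgroup.closure {x, y} = (⊤ : Subgroup Q) →
      (Z : Set Q) ⊆ beauvilleSigma x y) : ¬ IsBeauvilleGroup Q := by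
  rintro ⟨-, -, x₁, y₁, x₂, y₂, hS⟩
  refine hZ ((Subgroup.eq_bot_iff_forall Z).2 fun z hz => ?_)
  have : z ∈ beauvilleSigma x₁ y₁ ∩ beauvilleSigma x₂ y₂ :=
    ⟨h x₁ y₁ hS.generates_left hz, h x₂ y₂ hS.generates_right hz⟩
  rw [hS.inter_eq] at this
  exact this

/-! ### Growing GGS-groups -/

theorem exists_isCongruenceQuotient (p : ℕ) (m : ℕ → ℕ) (e : ℕ → ℤ) (n : ℕ) :
    ∃ φ : (group p m e ⧸ levelStabilizer (group p m e) n) →*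
        Equiv.Perm (Level (branching p m) n),
      IsCongruenceQuotient (p ^ m 0) e φ (QuotientGroup.mk (genA p m e))
        (QuotientGroup.mk (genB p m e)) := by
  let ρ : group p m e →* Equiv.Perm (Level (branching p m) n) :=
    (Pi.evalMonoidHom _ n).comp ((AutT (branching p m)).subtype.comp (group p m e).subtype)
  have hker : ∀ g, g ∈ levelStabilizer (group p m e) n ↔ ρ g = 1 := fun g =>
    ⟨fun hg => Equiv.ext hg, fun hg v => DFunLike.congr_fun hg v⟩
  refine ⟨QuotientGroup.lift _ ρ fun g hg => (hker g).1 hg, ?_, rfl, rfl, ?_⟩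
  · rw [injective_iff_map_eq_one]
    intro x hx
    obtain ⟨g, rfl⟩ := QuotientGroup.mk_surjective x
    exact (QuotientGroup.eq_one_iff g).2 ((hker g).2 hx)
  · have hgen : Subgroup.closure {genA p m e, genB p m e} = (⊤ : Subgroup (group p m e)) := by
      have := Subgroup.closure_closure_coe_preimage
        (k := ({rootedAut p m, directedAut p m e} : Set (AutT (branching p m))))
      refine top_unique (this.symm.le.trans (Subgroup.closure_mono ?_))
      rintro ⟨x, hx⟩ (h | h)
      · exact Or.inl (Subtype.ext h)
      · exact Or.inr (Subtype.ext h)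
    have := congrArg (Subgroup.map (QuotientGroup.mk' (levelStabilizer (group p m e) n))) hgen
    rw [MonoidHom.map_closure, Set.image_pair, Subgroup.map_top_of_surjective _
      (QuotientGroup.mk'_surjective _)] at this
    exact this

theorem isAdmissible_branching {p : ℕ} (hp : p.Prime) {m : ℕ → ℕ} (hm_pos : 0 < m 0)
    (hm : StrictMono m) {e : ℕ → ℤ}
    (he : ∃ i ∈ Finset.Icc 1 (p ^ m 0 - 1), ¬ (p : ℤ) ∣ e i) :
    IsAdmissible (branching p m) (p ^ m 0) e where
  one_lt i := Nat.one_lt_pow (hm_pos.trans_le (hm.monotone i.zero_le)).ne' hp.one_lt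
  le i := Nat.pow_le_pow_right hp.pos (hm.monotone i.zero_le)
  dvd i := pow_dvd_pow p (hm.monotone i.le_succ)
  exists_coprime := by
    obtain ⟨r, hr, hpr⟩ := he
    rw [Finset.mem_Icc] at hr
    refine ⟨r, by omega, by omega, fun i => ?_⟩
    rw [branching, Nat.cast_pow]
    exact ((Nat.prime_iff_prime_int.1 hp).coprime_iff_not_dvd.2 hpr).pow_left

end GrowingGGS

theorem proposition1p2 (p : ℕ) (hp : p.Prime) (hp_odd : p ≠ 2)
    (m : ℕ → ℕ) (hm_pos : 0 < m 0) (hm : StrictMono m)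
    (e : ℕ → ℤ)
    (he_range : ∀ i ∈ Finset.Icc 1 (p ^ m 0 - 1), |e i| ≤ (p : ℤ) ^ m 1 - 1)
    (he_ne : ∃ i ∈ Finset.Icc 1 (p ^ m 0 - 1), ¬ (p : ℤ) ∣ e i) :
    (∑ i ∈ Finset.Icc 1 (p ^ m 0 - 1), e i = 0 →
      ∀ n : ℕ, 3 ≤ n →
        GrowingGGS.IsBeauvilleGroup
          (GrowingGGS.group p m e ⧸
            GrowingGGS.levelStabilizer (GrowingGGS.group p m e) n) ∧
        (5 ≤ p → ∀ a b : GrowingGGS.group p m e ⧸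
            GrowingGGS.levelStabilizer (GrowingGGS.group p m e) n,
          a = QuotientGroup.mk (GrowingGGS.genA p m e) →
          b = QuotientGroup.mk (GrowingGGS.genB p m e) →
          GrowingGGS.IsBeauvilleStructure (a ^ (-2 : ℤ)) (a * b) (a * b ^ 2) b)) ∧
    (¬ (p : ℤ) ∣ ∑ i ∈ Finset.Icc 1 (p ^ m 0 - 1), e i →
      ∀ n : ℕ, 1 ≤ n →
        ¬ GrowingGGS.IsBeauvilleGroup
          (GrowingGGS.group p m e ⧸
            GrowingGGS.levelStabilizer (GrowingGGS.group p m e) n) ∧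
        ∃ Z : Subgroup (GrowingGGS.group p m e ⧸
            GrowingGGS.levelStabilizer (GrowingGGS.group p m e) n),
          Z ≤ Subgroup.center _ ∧ IsCyclic Z ∧ Z ≠ ⊥ ∧
          ∀ x y : GrowingGGS.group p m e ⧸
              GrowingGGS.levelStabilizer (GrowingGGS.group p m e) n,
            Subgroup.closure {x, y} = ⊤ → (Z : Set _) ⊆ GrowingGGS.beauvilleSigma x y) := by
  have hA := GrowingGGS.isAdmissible_branching hp hm_pos hm he_ne
  have hp3 : 3 ≤ p := by
    have := hp.two_le
    omega
  refine ⟨fun hsum n hn => ?_, fun hsum n hn => ?_⟩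
  · obtain ⟨n, rfl⟩ := Nat.exists_eq_add_of_le' hn
    obtain ⟨φ, h⟩ := GrowingGGS.exists_isCongruenceQuotient p m e (n + 3)
    have h5 := fun hp5 : 5 ≤ p => h.isBeauvilleStructure_of_five_le hA hsum hp hp5 fun _ => rfl
    refine ⟨⟨h.finite hA.ne_zero, h.not_isCyclic hA, ?_⟩, fun hp5 a b ha hb => ha ▸ hb ▸ h5 hp5⟩
    obtain hp5 | hp5 := le_or_gt 5 p
    · exact ⟨_, _, _, _, h5 hp5⟩
    · obtain rfl : p = 3 := by
        have : p ≠ 4 := by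
          rintro rfl
          exact absurd hp (by decide)
        omega
      have hlt : m 0 < m (n + 2) := hm (by omega)
      have ha := GrowingGGS.HasExponents.left (QuotientGroup.mk (GrowingGGS.genA 3 m e))
        (QuotientGroup.mk (GrowingGGS.genB 3 m e) : _ ⧸ GrowingGGS.levelStabilizer _ (n + 3))
      have hb := GrowingGGS.HasExponents.right (QuotientGroup.mk (GrowingGGS.genA 3 m e))
        (QuotientGroup.mk (GrowingGGS.genB 3 m e) : _ ⧸ GrowingGGS.levelStabilizer _ (n + 3))
      obtain hm1 | hm1 : m 0 = 1 ∨ 2 ≤ m 0 := by omega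
      · rw [hm1, pow_one] at h hA hsum he_ne
        have hIcc : Finset.Icc 1 (3 - 1) = {1, 2} := by decide
        have he1 : ¬ (3 : ℤ) ∣ e 1 := by
          obtain ⟨r, hr, hr3⟩ := he_ne
          rw [hIcc] at hr
          rw [hIcc, Finset.sum_pair (by decide)] at hsum
          simp only [Finset.mem_insert, Finset.mem_singleton] at hr
          push_cast at hr3
          rcases hr with rfl | rfl <;> omega
        have hcop : ∀ i, IsCoprime (GrowingGGS.branching 3 m i : ℤ) (e 1) := fun i => by
          rw [GrowingGGS.branching, Nat.cast_pow]
          exact (Int.prime_three.coprime_iff_not_dvd.2 he1).pow_left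
        have hq0 : GrowingGGS.branching 3 m 0 = 3 := by rw [GrowingGGS.branching, hm1, pow_one]
        exact ⟨_, _, _, _, h.isBeauvilleStructure_three hA hsum (fun _ => rfl) hlt
          (hb.mul (hb.conj _)) (h.conjTrivialInter_right_mul_conj hA hq0 hsum hcop)
          (by norm_num) (by norm_num)⟩
      · have h3 : ¬ (GrowingGGS.branching 3 m 0 : ℤ) ∣ 3 := by
          intro hd
          have h9 : (3 : ℤ) ^ 2 ∣ 3 := by
            refine (pow_dvd_pow 3 hm1).trans ?_
            simpa [GrowingGGS.branching] using hd
          norm_num at h9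
        exact ⟨_, _, _, _, h.isBeauvilleStructure_three hA hsum (fun _ => rfl) hlt
          ((ha.zpow 3).mul (hb.zpow (-1))) (h.conjTrivialInter_right hA h3 (-1))
          (by norm_num) (by norm_num)⟩
  · obtain ⟨n, rfl⟩ := Nat.exists_eq_add_of_le' hn
    obtain ⟨φ, h⟩ := GrowingGGS.exists_isCongruenceQuotient p m e (n + 1)
    obtain ⟨Z, hZc, hZcyc, hZ, hZsub⟩ := h.exists_central_subgroup hA.pos hA.le hp (fun _ => rfl)
      (fun i => hm_pos.trans_le (hm.monotone i.zero_le)) hsum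
    exact ⟨GrowingGGS.not_isBeauvilleGroup_of_central_subgroup hZ hZsub, Z, hZc, hZcyc, hZ, hZsub⟩
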